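/- Let $I_1,I_2$ be independent random variables such that, for $i=1,2$, $I_i$ has the mixture Exponential-Generalized Gamma density $$f_{I_i}(x)=\frac{\omega_i}{\lambda_i}e^{-x/\lambda_i}+(1-\omega_i)\frac{c_i\,x^{a_ic_i-1}}{b_i^{a_ic_i}\Gamma(a_i)}e^{-(x/b_i)^{c_i}},\qquad x>0,$$ where $0<\omega_i<1$ and $\lambda_i,a_i,b_i,c_i>0$. Let $r_1,r_2\in\{1,2\}$, let $\eta,N_{01},N_{02},C>0$, and put $\gamma_i=(\eta I_i)^{r_i}/N_{0i}$ and $\mu_i=\eta^{r_i}/N_{0i}$. Let $\gamma=\gamma_1\gamma_2/(\gamma_2+C)$ be the end-to-end SNR of the dual-hop system. Let $n\in\mathbb N$, $\delta\in\mathbb R$, $p>0$ and $q_1,\dots,q_n>0$. For $x,y>0$ and pairs $u=(u_1,u_2)$, $v=(v_1,v_2)$ of real numbers, the bivariate Fox H-function $$H(u,v;x,y)=\mathrm H^{0,1:1,1:2,0}_{1,0:1,2:0,2}\left[\begin{matrix}(1;1,1)\\ -\end{matrix}\middle|\begin{matrix}u\\(p,1)(0,1)\end{matrix}\middle|\begin{matrix}-\\(0,1)\,v\end{matrix}\middle|\,x,y\right]$$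 is the double Mellin-Barnes integral $$\frac1{(2\pi i)^2}\int_{\operatorname{Re}s=\sigma}\int_{\operatorname{Re}t=\tau}\Gamma(s+t)\,\frac{\Gamma(p-s)\,\Gamma(1-u_1+u_2s)}{\Gamma(1+s)}\,\Gamma(-t)\,\Gamma(v_1-v_2t)\,x^s y^t\,dt\,ds$$ over vertical lines, directed upwards, on which the arguments of all Gamma functions in the numerator have positive real part. Then $\gamma$ has a probability density $f_\gamma$, the functions $x\mapsto\Gamma(p,q_kx)f_\gamma(x)$ are integrable on $(0,\infty)$, where $\Gamma(\cdot,\cdot)$ is the upper incomplete Gamma function, and the average bit-error rate $$P_e=\frac{\delta}{2\Gamma(p)}\sum_{k=1}^n\int_0^\infty\Gamma(p,q_kx)\,f_\gamma(x)\,dx$$ is given by $$\begin{aligned}P_e=\delta\sum_{k=1}^n\Big\{\frac12&-\frac{\omega_1\omega_2}{2\Gamma(p)}H\Big((0,r_1),(1,r_2);\,q_k\lambda_1^{r_1}\mu_1,\,\frac{C}{\lambda_2^{r_2}\mu_2}\Big)\\ &-\frac{\omega_1(1-\omega_2)}{2\Gamma(a_2)\Gamma(p)}H\Big((0,r_1),\big(a_2,\tfrac{r_2}{c_2}\big);\,q_k\lambda_1^{r_1}\mu_1,\,\frac{C}{b_2^{r_2}\mu_2}\Big)\\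 &-\frac{\omega_2(1-\omega_1)}{2\Gamma(a_1)\Gamma(p)}H\Big(\big(1-a_1,\tfrac{r_1}{c_1}\big),(1,r_2);\,q_kb_1^{r_1}\mu_1,\,\frac{C}{\lambda_2^{r_2}\mu_2}\Big)\\ &-\frac{(1-\omega_1)(1-\omega_2)}{2\Gamma(a_1)\Gamma(a_2)\Gamma(p)}H\Big(\big(1-a_1,\tfrac{r_1}{c_1}\big),\big(a_2,\tfrac{r_2}{c_2}\big);\,q_kb_1^{r_1}\mu_1,\,\frac{C}{b_2^{r_2}\mu_2}\Big)\Big\}.\end{aligned}$$ Moreover, for each of these four H-functions at these arguments, admissible pairs of lines exist, and the double integral converges absolutely over each of them with a value that does not depend on the choice. -/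

import Mathlib

open MeasureTheory ProbabilityTheory Set

noncomputable section

namespace UWOC

/-- The mixture Exponential-Generalized Gamma (EGG) density on `(0, ∞)`. -/
def eggPDF (ω lam a b c x : ℝ) : ℝ :=
  ω / lam * Real.exp (-(x / lam)) +
    (1 - ω) * (c * x ^ (a * c - 1) / (b ^ (a * c) * Real.Gamma a)) * Real.exp (-(x / b) ^ c)

/-- The EGG distribution, as a measure on `ℝ` concentrated on `(0, ∞)`. -/
def eggMeasure (ω lam a b c : ℝ) : Measure ℝ :=
  (volume.restrict (Ioi 0)).withDensity fun x => ENNReal.ofReal (eggPDF ω lam a b c x)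

/-- Instantaneous SNR `(η I) ^ r / N₀` of a hop with irradiance `I`
(`r = 1`: heterodyne detection, `r = 2`: IM/DD). -/
def hopSNR (η N₀ : ℝ) (r : ℕ) (I : ℝ) : ℝ := (η * I) ^ r / N₀

/-- Electrical SNR parameter of a hop: the SNR at unit (that is, normalized mean) irradiance. -/
def electricalSNR (η N₀ : ℝ) (r : ℕ) : ℝ := η ^ r / N₀

/-- End-to-end SNR of a dual-hop system with a fixed gain amplify-and-forward relay. -/
def endToEndSNR (C γ₁ γ₂ : ℝ) : ℝ := γ₁ * γ₂ / (γ₂ + C)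

/-- Upper incomplete Gamma function `Γ(p, x)`. -/
def upperGamma (p x : ℝ) : ℝ := ∫ t in Ioi x, t ^ (p - 1) * Real.exp (-t)

/-- The generalized average bit-error rate of an SNR with probability density `f` on `(0, ∞)`. -/
def averageBER {n : ℕ} (δ p : ℝ) (q : Fin n → ℝ) (f : ℝ → ℝ) : ℝ :=
  δ / (2 * Real.Gamma p) * ∑ k, ∫ x in Ioi 0, upperGamma p (q k * x) * f x

/-- Data of one of the two single-variable factors of a bivariate Fox H-function: the orders `m, n`,
the upper pairs `(c_j, γ_j)` and the lower pairs `(d_j, δ_j)`. The remaining two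
orders `p, q` are the lengths of the two lists. -/
structure FoxFactor where
  /-- number of lower pairs in the numerator -/
  m : ℕ
  /-- number of upper pairs in the numerator -/
  n : ℕ
  /-- upper pairs -/
  upper : List (ℝ × ℝ)
  /-- lower pairs -/
  lower : List (ℝ × ℝ)

/-- `∏_{j ≤ m} Γ(d_j - δ_j s) ∏_{j ≤ n} Γ(1 - c_j + γ_j s)` divided by
`∏_{j > m} Γ(1 - d_j + δ_j s) ∏_{j > n} Γ(c_j - γ_j s)`. -/
def FoxFactor.eval (F : FoxFactor) (s : ℂ) : ℂ :=
  ((F.lower.take F.m).map fun d => Complex.Gamma (d.1 - d.2 * s)).prod *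
      ((F.upper.take F.n).map fun c => Complex.Gamma (1 - c.1 + c.2 * s)).prod /
    (((F.lower.drop F.m).map fun d => Complex.Gamma (1 - d.1 + d.2 * s)).prod *
      ((F.upper.drop F.n).map fun c => Complex.Gamma (c.1 - c.2 * s)).prod)

/-- Data of a bivariate Fox H-function with orders `0, n : m₂, n₂ : m₃, n₃` (above) and
`p, q : p₂, q₂ : p₃, q₃` (below): the coupled upper triples `(a_j; α_j, A_j)`, `j ≤ p`, the
coupled lower triples `(b_j; β_j, B_j)`, `j ≤ q`, and the two single-variable factors. -/
structure FoxData where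
  /-- number of coupled upper triples in the numerator -/
  n : ℕ
  /-- coupled upper triples -/
  upper : List (ℝ × ℝ × ℝ)
  /-- coupled lower triples -/
  lower : List (ℝ × ℝ × ℝ)
  /-- factor in the first variable -/
  fst : FoxFactor
  /-- factor in the second variable -/
  snd : FoxFactor

namespace FoxData

/-- `∏_{j ≤ n} Γ(1 - a_j + α_j s + A_j t)` divided by
`∏_{j > n} Γ(a_j - α_j s - A_j t) ∏_j Γ(1 - b_j + β_j s + B_j t)`. -/
def coupled (D : FoxData) (s t : ℂ) : ℂ :=
  ((D.upper.take D.n).map fun a => Complex.Gamma (1 - a.1 + a.2.1 * s + a.2.2 * t)).prod /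
    (((D.upper.drop D.n).map fun a => Complex.Gamma (a.1 - a.2.1 * s - a.2.2 * t)).prod *
      (D.lower.map fun b => Complex.Gamma (1 - b.1 + b.2.1 * s + b.2.2 * t)).prod)

/-- The Mellin-Barnes integrand of the bivariate Fox H-function. -/
def integrand (D : FoxData) (x y : ℝ) (s t : ℂ) : ℂ :=
  D.coupled s t * D.fst.eval s * D.snd.eval t * (x : ℂ) ^ s * (y : ℂ) ^ t

/-- The vertical lines `Re s = σ`, `Re t = τ` are separating contours: every Gamma factor of the
numerator has an argument with positive real part there. For positive coefficients this means
that the poles of `Γ(d_j - δ_j s)` lie to the right of the contour and those of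
`Γ(1 - c_j + γ_j s)` and `Γ(1 - a_j + α_j s + A_j t)` to the left of it, and likewise for `t`. -/
def Separates (D : FoxData) (σ τ : ℝ) : Prop :=
  (∀ a ∈ D.upper.take D.n, 0 < 1 - a.1 + a.2.1 * σ + a.2.2 * τ) ∧
  (∀ d ∈ D.fst.lower.take D.fst.m, 0 < d.1 - d.2 * σ) ∧
  (∀ c ∈ D.fst.upper.take D.fst.n, 0 < 1 - c.1 + c.2 * σ) ∧
  (∀ d ∈ D.snd.lower.take D.snd.m, 0 < d.1 - d.2 * τ) ∧
  (∀ c ∈ D.snd.upper.take D.snd.n, 0 < 1 - c.1 + c.2 * τ)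

/-- The integrand on the contours, as a function of the two imaginary parts. -/
def lineIntegrand (D : FoxData) (x y σ τ : ℝ) (w : ℝ × ℝ) : ℂ :=
  D.integrand x y (σ + w.1 * Complex.I) (τ + w.2 * Complex.I)

/-- `(2πi)⁻² ∫∫ (integrand) ds dt` over `Re s = σ`, `Re t = τ`; here `ds dt = i² du dv`. -/
def contourIntegral (D : FoxData) (x y σ τ : ℝ) : ℂ :=
  1 / (2 * Real.pi * Complex.I) ^ 2 *
    (Complex.I ^ 2 * ∫ w : ℝ × ℝ, D.lineIntegrand x y σ τ w)

open Classical in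
/-- The bivariate Fox H-function: the double Mellin-Barnes integral over separating vertical
contours (`0` if there are none). -/
def foxH (D : FoxData) (x y : ℝ) : ℂ :=
  if h : ∃ c : ℝ × ℝ, D.Separates c.1 c.2 then
    D.contourIntegral x y h.choose.1 h.choose.2 else 0

/-- `D.foxH x y` is well defined: there are separating vertical contours, and over all of them the
double integral converges absolutely with the same value `D.foxH x y`. -/
def WellDefinedAt (D : FoxData) (x y : ℝ) : Prop :=
  (∃ σ τ : ℝ, D.Separates σ τ) ∧
  ∀ σ τ : ℝ, D.Separates σ τ →
    Integrable (D.lineIntegrand x y σ τ) ∧ D.contourIntegral x y σ τ = D.foxH x y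

end FoxData

/-- The data of
`H^{0,1:1,1:2,0}_{1,0:1,2:0,2}[(1;1,1); -- | u; (p,1)(0,1) | --; (0,1) v | ·, ·]`. -/
def berFox (p : ℝ) (u v : ℝ × ℝ) : FoxData where
  n := 1
  upper := [(1, 1, 1)]
  lower := []
  fst := { m := 1, n := 1, upper := [u], lower := [(p, 1), (0, 1)] }
  snd := { m := 2, n := 0, upper := [], lower := [(0, 1), v] }

end UWOC

end

/-
Since `Γ(p, x) = Γ(p) - γ(p, x)`, the average bit-error rate only involves the expectation of the
bounded function `γ(p, q · SNR)`. Each irradiance is a mixture of laws of `b G ^ (1 / c)` with `G`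
Gamma distributed, an exponential variable being the case `a = c = 1`, so this expectation splits
into four terms `E γ(p, x G₁ ^ α / (1 + y G₂ ^ (-β)))`. On the other side,
`(2πi)⁻² ∬ Γ(s + t) Γ(-t) Γ(p - s) / Γ(1 + s) x ^ s y ^ t dt ds = γ(p, x / (1 + y))`,
and the two remaining Gamma factors of the Fox integrand are the moments
`Γ(a₁ + α s) = Γ(a₁) E G₁ ^ (α s)` and `Γ(a₂ - β t) = Γ(a₂) E G₂ ^ (-β t)`. Fubini, justified by the
rapid decay of `Γ` on vertical lines, then identifies each term with an H-function, on every
admissible pair of lines.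
-/

noncomputable section

namespace UWOC

open Complex (I)

theorem norm_Gamma_le {s : ℂ} (hs : 0 < s.re) : ‖Complex.Gamma s‖ ≤ Real.Gamma s.re := by
  rw [Complex.Gamma_eq_integral hs, Complex.GammaIntegral, Real.Gamma_eq_integral hs]
  refine (norm_integral_le_integral_norm _).trans_eq ?_
  refine setIntegral_congr_fun measurableSet_Ioi fun t ht => ?_
  simp only [norm_mul, Complex.norm_real, Complex.norm_cpow_eq_rpow_re_of_pos ht, Real.norm_eq_abs,
    Real.abs_exp, Complex.sub_re, Complex.one_re]

theorem ofReal_add_mul_I_ne_zero {c : ℝ} (hc : c ≠ 0) (v : ℝ) : (c + v * I : ℂ) ≠ 0 :=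
  fun h => hc (by simpa using congrArg Complex.re h)

theorem one_add_abs_le_mul_norm {c : ℝ} (hc : 0 < c) (v : ℝ) :
    1 + |v| ≤ (1 / c + 1) * ‖(c + v * I : ℂ)‖ := by
  have hre : c ≤ ‖(c + v * I : ℂ)‖ := by
    simpa [abs_of_pos hc] using Complex.abs_re_le_norm (c + v * I)
  have him : |v| ≤ ‖(c + v * I : ℂ)‖ := by
    simpa using Complex.abs_im_le_norm (c + v * I)
  have hone : 1 ≤ 1 / c * ‖(c + v * I : ℂ)‖ := by
    rwa [one_div_mul_eq_div, one_le_div hc]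
  linarith

theorem norm_le_mul_one_add_abs {c : ℝ} (hc : 0 ≤ c) (v : ℝ) :
    ‖(c + v * I : ℂ)‖ ≤ (c + 1) * (1 + |v|) := by
  have h : ‖(c + v * I : ℂ)‖ ≤ c + |v| := by
    simpa [abs_of_nonneg hc] using norm_add_le (c : ℂ) (v * I)
  nlinarith [abs_nonneg v]

theorem exists_norm_Gamma_mul_pow_le {c : ℝ} (hc : 0 < c) (n : ℕ) :
    ∃ A : ℝ, ∀ v : ℝ, ‖Complex.Gamma (c + v * I)‖ * (1 + |v|) ^ n ≤ A := by
  induction n generalizing c with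
  | zero =>
    refine ⟨Real.Gamma c, fun v => ?_⟩
    simpa using norm_Gamma_le (s := c + v * I) (by simpa using hc)
  | succ n ih =>
    obtain ⟨A, hA⟩ := ih (c := c + 1) (by positivity)
    refine ⟨(1 / c + 1) * A, fun v => ?_⟩
    have hrec : Complex.Gamma ((c + 1 : ℝ) + v * I) = (c + v * I) * Complex.Gamma (c + v * I) := by
      rw [← Complex.Gamma_add_one _ (ofReal_add_mul_I_ne_zero hc.ne' v)]
      congr 1
      push_cast
      ring
    calc ‖Complex.Gamma (c + v * I)‖ * (1 + |v|) ^ (n + 1)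
        = ‖Complex.Gamma (c + v * I)‖ * (1 + |v|) ^ n * (1 + |v|) := by ring
      _ ≤ ‖Complex.Gamma (c + v * I)‖ * (1 + |v|) ^ n * ((1 / c + 1) * ‖(c + v * I : ℂ)‖) := by
        gcongr
        exact one_add_abs_le_mul_norm hc v
      _ = (1 / c + 1) * (‖Complex.Gamma ((c + 1 : ℝ) + v * I)‖ * (1 + |v|) ^ n) := by
        rw [hrec, norm_mul]
        ring
      _ ≤ (1 / c + 1) * A := by gcongr; exact hA v

theorem exists_norm_Gamma_add_nat_le {y : ℝ} (hy : 0 < y) (n : ℕ) : ∃ A : ℝ, 0 ≤ A ∧ ∀ u : ℝ,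
    ‖Complex.Gamma ((y + n : ℝ) + u * I)‖ ≤
      A * (1 + |u|) ^ n * ‖Complex.Gamma (y + u * I)‖ := by
  induction n with
  | zero => exact ⟨1, zero_le_one, fun u => by simp⟩
  | succ n ih =>
    obtain ⟨A, hA, h⟩ := ih
    refine ⟨(y + n + 1) * A, by positivity, fun u => ?_⟩
    have hrec : Complex.Gamma ((y + (n + 1 : ℕ) : ℝ) + u * I) =
        ((y + n : ℝ) + u * I) * Complex.Gamma ((y + n : ℝ) + u * I) := by
      rw [← Complex.Gamma_add_one _ (ofReal_add_mul_I_ne_zero (by positivity) u)]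
      congr 1
      push_cast
      ring
    calc ‖Complex.Gamma ((y + (n + 1 : ℕ) : ℝ) + u * I)‖
        = ‖((y + n : ℝ) + u * I : ℂ)‖ * ‖Complex.Gamma ((y + n : ℝ) + u * I)‖ := by
          rw [hrec, norm_mul]
      _ ≤ ((y + n + 1) * (1 + |u|)) * (A * (1 + |u|) ^ n * ‖Complex.Gamma (y + u * I)‖) :=
        mul_le_mul (norm_le_mul_one_add_abs (by positivity) u) (h u) (norm_nonneg _)
          (by positivity)
      _ = (y + n + 1) * A * (1 + |u|) ^ (n + 1) * ‖Complex.Gamma (y + u * I)‖ := by ring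

theorem norm_betaIntegral_le (s t : ℂ) :
    ‖Complex.betaIntegral s t‖ ≤ ∫ x in (0 : ℝ)..1, x ^ (s.re - 1) * (1 - x) ^ (t.re - 1) := by
  rw [Complex.betaIntegral]
  refine (intervalIntegral.norm_integral_le_integral_norm zero_le_one).trans_eq ?_
  rw [intervalIntegral.integral_of_le zero_le_one, intervalIntegral.integral_of_le zero_le_one,
    integral_Ioc_eq_integral_Ioo, integral_Ioc_eq_integral_Ioo]
  refine setIntegral_congr_fun measurableSet_Ioo fun x hx => ?_
  have hsub : (1 - x : ℂ) = (1 - x : ℝ) := by push_cast; rfl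
  simp only [norm_mul, hsub, Complex.norm_cpow_eq_rpow_re_of_pos hx.1,
    Complex.norm_cpow_eq_rpow_re_of_pos (sub_pos.2 hx.2), Complex.sub_re, Complex.one_re]

theorem norm_Gamma_mul_Gamma_le {s : ℂ} {d : ℝ} (hs : 0 < s.re) (hd : 0 < d) :
    ‖Complex.Gamma s‖ * Real.Gamma d ≤
      ‖Complex.Gamma (s + d)‖ * ∫ x in (0 : ℝ)..1, x ^ (s.re - 1) * (1 - x) ^ (d - 1) := by
  have hbeta := Complex.Gamma_mul_Gamma_eq_betaIntegral hs (t := d) (by simpa using hd)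
  calc ‖Complex.Gamma s‖ * Real.Gamma d
      = ‖Complex.Gamma (s + d)‖ * ‖Complex.betaIntegral s d‖ := by
        rw [← norm_mul, ← hbeta, norm_mul, Complex.Gamma_ofReal, Complex.norm_real,
          Real.norm_of_nonneg (Real.Gamma_pos_of_pos hd).le]
    _ ≤ _ := by gcongr; simpa using norm_betaIntegral_le s d

theorem exists_norm_Gamma_div_norm_Gamma_le {x y : ℝ} (hx : 0 < x) (hy : 0 < y) :
    ∃ (A : ℝ) (n : ℕ), 0 ≤ A ∧ ∀ u : ℝ,
      ‖Complex.Gamma (x + u * I)‖ / ‖Complex.Gamma (y + u * I)‖ ≤ A * (1 + |u|) ^ n := by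
  obtain ⟨n, hn⟩ := exists_nat_gt x
  obtain ⟨A, hA, hshift⟩ := exists_norm_Gamma_add_nat_le hy n
  have hd : 0 < y + n - x := by linarith
  have hΓd := Real.Gamma_pos_of_pos hd
  set B : ℝ := ∫ t in (0 : ℝ)..1, t ^ (x - 1) * (1 - t) ^ (y + n - x - 1)
  have hcmp (u : ℝ) : ‖Complex.Gamma (x + u * I)‖ * Real.Gamma (y + n - x) ≤
      ‖Complex.Gamma ((y + n : ℝ) + u * I)‖ * B := by
    have h := norm_Gamma_mul_Gamma_le (s := x + u * I) (by simpa using hx) hd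
    rw [show (x + u * I + (y + n - x : ℝ) : ℂ) = (y + n : ℝ) + u * I by push_cast; ring] at h
    simpa using h
  have hB0 : 0 ≤ B := intervalIntegral.integral_nonneg zero_le_one fun t ht =>
    mul_nonneg (Real.rpow_nonneg ht.1 _) (Real.rpow_nonneg (sub_nonneg.2 ht.2) _)
  refine ⟨A * B / Real.Gamma (y + n - x), n, by positivity, fun u => ?_⟩
  have hΓy : 0 < ‖Complex.Gamma (y + u * I)‖ :=
    norm_pos_iff.2 (Complex.Gamma_ne_zero_of_re_pos (by simpa using hy))
  rw [div_le_iff₀ hΓy, div_mul_eq_mul_div, div_mul_eq_mul_div, le_div_iff₀ hΓd]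
  calc ‖Complex.Gamma (x + u * I)‖ * Real.Gamma (y + n - x)
      ≤ ‖Complex.Gamma ((y + n : ℝ) + u * I)‖ * B := hcmp u
    _ ≤ A * (1 + |u|) ^ n * ‖Complex.Gamma (y + u * I)‖ * B := by gcongr; exact hshift u
    _ = A * B * (1 + |u|) ^ n * ‖Complex.Gamma (y + u * I)‖ := by ring

theorem continuous_Gamma_comp {X : Type*} [TopologicalSpace X] {f : X → ℂ} (hf : Continuous f)
    (h : ∀ x, 0 < (f x).re) : Continuous fun x => Complex.Gamma (f x) := by
  refine continuous_iff_continuousAt.2 fun x => ?_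
  refine (Complex.continuousAt_Gamma (f x) fun m hm => ?_).comp hf.continuousAt
  have hre : (f x).re = -m := by simp [hm]
  linarith [h x, m.cast_nonneg (α := ℝ)]

theorem integrable_inv_one_add_abs_sq : Integrable fun v : ℝ => ((1 + |v|) ^ 2)⁻¹ := by
  have h := integrable_one_add_norm (E := ℝ) (μ := volume) (r := 2) (by simp)
  refine h.congr (.of_forall fun v => ?_)
  simp only [Real.norm_eq_abs]
  rw [Real.rpow_neg (by positivity), Real.rpow_two]

theorem verticalIntegrable_Gamma {c : ℝ} (hc : 0 < c) :
    Complex.VerticalIntegrable Complex.Gamma c := by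
  obtain ⟨A, hA⟩ := exists_norm_Gamma_mul_pow_le hc 2
  refine (integrable_inv_one_add_abs_sq.const_mul A).mono'
    (continuous_Gamma_comp (by fun_prop) fun _ => by simpa using hc).aestronglyMeasurable
    (.of_forall fun v => ?_)
  rw [← div_eq_mul_inv, le_div_iff₀ (by positivity)]
  exact hA v

theorem mellinInv_Gamma {c x : ℝ} (hc : 0 < c) (hx : 0 < x) :
    mellinInv c Complex.Gamma x = Real.exp (-x) := by
  have hmellin {s : ℂ} (hs : 0 < s.re) :
      mellin (fun x : ℝ => ((Real.exp (-x) : ℝ) : ℂ)) s = Complex.Gamma s := by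
    rw [← Complex.GammaIntegral_eq_mellin, Complex.Gamma_eq_integral hs]
  have hline (v : ℝ) : mellin (fun x : ℝ => ((Real.exp (-x) : ℝ) : ℂ)) (c + v * I) =
      Complex.Gamma (c + v * I) := hmellin (by simpa using hc)
  have hconv : MellinConvergent (fun x : ℝ => ((Real.exp (-x) : ℝ) : ℂ)) c := by
    refine (Complex.GammaIntegral_convergent (s := c) (by simpa using hc)).congr_fun
      (fun t _ => ?_) measurableSet_Ioi
    rw [smul_eq_mul, mul_comm]
  have hinv := mellinInv_mellin_eq c (fun x : ℝ => ((Real.exp (-x) : ℝ) : ℂ)) hx hconv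
    (by simpa only [Complex.VerticalIntegrable, hline] using verticalIntegrable_Gamma hc)
    (by fun_prop)
  simpa only [mellinInv, hline] using hinv

theorem integral_mul_integral_swap {𝕜 W Z : Type*} [RCLike 𝕜] [MeasurableSpace W]
    [MeasurableSpace Z] {μ : Measure W} {ν : Measure Z} [SFinite μ] [SFinite ν] {K : W → 𝕜}
    {φ : W → Z → 𝕜} {ψ : Z → ℝ} (hK : Integrable K μ) (hψ : Integrable ψ ν)
    (hφ : AEStronglyMeasurable (Function.uncurry φ) (μ.prod ν))
    (hb : ∀ᵐ z ∂ν, ∀ w, ‖φ w z‖ ≤ ψ z) :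
    ∫ w, K w * ∫ z, φ w z ∂ν ∂μ = ∫ z, ∫ w, K w * φ w z ∂μ ∂ν := by
  have hint : Integrable (Function.uncurry fun w z => K w * φ w z) (μ.prod ν) := by
    refine (hK.norm.mul_prod hψ).mono' (hK.aestronglyMeasurable.comp_fst.mul hφ) ?_
    filter_upwards [Measure.quasiMeasurePreserving_snd.ae hb] with q hq
    simp only [Function.uncurry, norm_mul]
    gcongr
    exact hq q.1
  rw [← integral_integral_swap hint]
  simp_rw [integral_const_mul]

theorem norm_cpow_line {x : ℝ} (hx : 0 < x) (σ u : ℝ) :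
    ‖(x : ℂ) ^ (σ + u * I : ℂ)‖ = x ^ σ := by
  rw [Complex.norm_cpow_eq_rpow_re_of_pos hx]
  simp

theorem continuous_cpow_comp {X : Type*} [TopologicalSpace X] {x : ℝ} (hx : 0 < x)
    {f : X → ℂ} (hf : Continuous f) : Continuous fun u => (x : ℂ) ^ f u :=
  hf.const_cpow (.inl (by exact_mod_cast hx.ne'))

theorem integrable_mul_cpow_line {K : ℝ → ℂ} (hK : Integrable K) {x : ℝ} (hx : 0 < x) (σ : ℝ) :
    Integrable fun u : ℝ => K u * (x : ℂ) ^ (σ + u * I : ℂ) :=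
  hK.mul_bdd (c := x ^ σ) (continuous_cpow_comp hx (by fun_prop)).aestronglyMeasurable
    (.of_forall fun u => (norm_cpow_line hx σ u).le)

/- Both Mellin-Barnes integrals below are superpositions of the inverse Mellin transform of `Γ`:
the extra factor of the integrand is itself an integral of powers `z ^ s`, which only rescale the
argument. -/
theorem integral_mul_cpow_mul_integral_cpow {K : ℝ → ℂ} (hK : Integrable K) {ν : Measure ℝ}
    [SFinite ν] (hν : ∀ᵐ z ∂ν, 0 < z) {w : ℝ → ℂ} (hw : AEStronglyMeasurable w ν) {σ : ℝ}
    (hwσ : Integrable (fun z => ‖w z‖ * z ^ σ) ν) {x : ℝ} (hx : 0 < x) :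
    ∫ u : ℝ, K u * (x : ℂ) ^ (σ + u * I : ℂ) * ∫ z, w z * (z : ℂ) ^ (σ + u * I : ℂ) ∂ν =
      ∫ z, w z * (∫ u : ℝ, K u * ((x * z : ℝ) : ℂ) ^ (σ + u * I : ℂ)) ∂ν := by
  rw [integral_mul_integral_swap (integrable_mul_cpow_line hK hx σ) hwσ]
  · refine integral_congr_ae ?_
    filter_upwards [hν] with z hz
    rw [← integral_const_mul]
    congr with u
    rw [Complex.ofReal_mul, Complex.mul_cpow_ofReal_nonneg hx.le hz.le]
    ring
  · refine hw.comp_snd.mul (Measurable.aestronglyMeasurable ?_)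
    fun_prop
  · filter_upwards [hν] with z hz u
    rw [norm_mul, norm_cpow_line hz]

theorem integral_Gamma_neg_mul_cpow {τ x : ℝ} (hτ : τ < 0) (hx : 0 < x) :
    ∫ v : ℝ, Complex.Gamma (-(τ + v * I)) * (x : ℂ) ^ (τ + v * I : ℂ) =
      2 * Real.pi * Real.exp (-x) := by
  have hinv := mellinInv_Gamma (neg_pos.2 hτ) hx
  rw [mellinInv, ← integral_neg_eq_self] at hinv
  have hneg (v : ℝ) : ((-τ : ℝ) : ℂ) + ((-v : ℝ) : ℂ) * I = -(τ + v * I) := by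
    push_cast
    ring
  simp only [hneg, neg_neg, smul_eq_mul] at hinv
  have h2π : (2 * Real.pi : ℂ) ≠ 0 := by simp [Real.pi_ne_zero]
  simp only [mul_comm (Complex.Gamma _), ← hinv, Complex.real_smul, ← mul_assoc]
  push_cast
  rw [mul_one_div_cancel h2π, one_mul]

theorem integrable_Gamma_sub_line {a σ : ℝ} (hσ : σ < a) :
    Integrable fun u : ℝ => Complex.Gamma (a - (σ + u * I)) := by
  refine (verticalIntegrable_Gamma (sub_pos.2 hσ)).comp_neg.congr (.of_forall fun u => ?_)
  simp only
  congr 1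
  push_cast
  ring

theorem Gamma_add_eq_setIntegral {s t : ℂ} (h : 0 < (s + t).re) :
    Complex.Gamma (s + t) =
      ∫ z in Ioi (0 : ℝ), (z : ℂ) ^ (s - 1) * Real.exp (-z) * (z : ℂ) ^ t := by
  rw [Complex.Gamma_eq_integral h, Complex.GammaIntegral]
  refine setIntegral_congr_fun measurableSet_Ioi fun z (hz : 0 < z) => ?_
  simp only [add_sub_right_comm s, Complex.cpow_add _ _ (Complex.ofReal_ne_zero.2 hz.ne')]
  ring

theorem integral_Gamma_add_mul_Gamma_neg_mul_cpow {s : ℂ} {τ y : ℝ} (hτ : τ < 0)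
    (hs : 0 < s.re + τ) (hy : 0 < y) :
    ∫ v : ℝ, Complex.Gamma (s + (τ + v * I)) * Complex.Gamma (-(τ + v * I)) *
        (y : ℂ) ^ (τ + v * I : ℂ) =
      2 * Real.pi * (Complex.Gamma s * ((1 / (1 + y) : ℝ) : ℂ) ^ s) := by
  let w (z : ℝ) : ℂ := (z : ℂ) ^ (s - 1) * Real.exp (-z)
  have hwτ : Integrable (fun z => ‖w z‖ * z ^ τ) (volume.restrict (Ioi (0 : ℝ))) := by
    refine (Real.GammaIntegral_convergent hs).congr_fun (fun z (hz : 0 < z) => ?_)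
      measurableSet_Ioi
    simp only [w, norm_mul, Complex.norm_cpow_eq_rpow_re_of_pos hz, Complex.norm_real,
      Real.norm_eq_abs, Real.abs_exp, add_sub_right_comm s.re, Real.rpow_add hz, Complex.sub_re,
      Complex.one_re]
    ring
  have hs0 : 0 < s.re := by linarith
  calc _ = ∫ v : ℝ, Complex.Gamma (-(τ + v * I)) * (y : ℂ) ^ (τ + v * I : ℂ) *
          ∫ z in Ioi (0 : ℝ), w z * (z : ℂ) ^ (τ + v * I : ℂ) := by
        congr with v
        rw [Gamma_add_eq_setIntegral (by simpa using hs)]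
        ring
    _ = ∫ z in Ioi (0 : ℝ), w z *
          ∫ v : ℝ, Complex.Gamma (-(τ + v * I)) * ((y * z : ℝ) : ℂ) ^ (τ + v * I : ℂ) :=
        integral_mul_cpow_mul_integral_cpow (ν := volume.restrict (Ioi 0))
          (by simpa using integrable_Gamma_sub_line hτ)
          (ae_restrict_mem measurableSet_Ioi)
          (Measurable.aestronglyMeasurable (by fun_prop)) hwτ hy
    _ = ∫ z in Ioi (0 : ℝ),
          2 * Real.pi * ((z : ℂ) ^ (s - 1) * Complex.exp (-((1 + y : ℝ) * z))) := by
        refine setIntegral_congr_fun measurableSet_Ioi fun z (hz : 0 < z) => ?_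
        have hexp : Complex.exp (-((1 + y : ℝ) * z)) = Real.exp (-z) * Real.exp (-(y * z)) := by
          rw [Complex.ofReal_exp, Complex.ofReal_exp, ← Complex.exp_add]
          push_cast
          ring_nf
        simp only [w, integral_Gamma_neg_mul_cpow hτ (mul_pos hy hz), hexp]
        ring
    _ = _ := by
        rw [integral_const_mul, Complex.integral_cpow_mul_exp_neg_mul_Ioi hs0 (by positivity)]
        push_cast
        ring

/-- The lower incomplete Gamma function `γ(p, x)`, the complement of `upperGamma` in `Γ(p)`: the
Mellin-Barnes integrals are evaluated in terms of it. It is `0` for `x ≤ 0`. -/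
def lowerGamma (p x : ℝ) : ℝ := ∫ t in Ioc 0 x, t ^ (p - 1) * Real.exp (-t)

theorem lowerGamma_eq_mul_setIntegral (p : ℝ) {x : ℝ} (hx : 0 ≤ x) :
    lowerGamma p x = x * ∫ w in Ioc 0 1, (x * w) ^ (p - 1) * Real.exp (-(x * w)) := by
  rw [lowerGamma, ← intervalIntegral.integral_of_le hx,
    ← intervalIntegral.integral_of_le zero_le_one,
    intervalIntegral.mul_integral_comp_mul_left (f := fun t : ℝ => t ^ (p - 1) * Real.exp (-t)),
    mul_zero, mul_one]

theorem integral_Gamma_sub_mul_cpow {p σ x : ℝ} (hσ : σ < p) (hx : 0 < x) :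
    ∫ u : ℝ, Complex.Gamma (p - (σ + u * I)) * (x : ℂ) ^ (σ + u * I : ℂ) =
      2 * Real.pi * ((x ^ p * Real.exp (-x) : ℝ) : ℂ) := by
  have hx0 : (x : ℂ) ≠ 0 := Complex.ofReal_ne_zero.2 hx.ne'
  calc _ = ∫ u : ℝ, (x : ℂ) ^ (p : ℂ) * (Complex.Gamma (-((σ - p : ℝ) + u * I)) *
          (x : ℂ) ^ ((σ - p : ℝ) + u * I : ℂ)) := by
        congr with u
        rw [show (σ + u * I : ℂ) = p + ((σ - p : ℝ) + u * I) by push_cast; ring,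
          Complex.cpow_add _ _ hx0, sub_add_cancel_left]
        ring
    _ = _ := by
        rw [integral_const_mul, integral_Gamma_neg_mul_cpow (sub_neg.2 hσ) hx,
          Complex.ofReal_mul, Complex.ofReal_cpow hx.le]
        ring

theorem setIntegral_inv_mul_cpow {s : ℂ} (hs : 0 < s.re) :
    ∫ w in Ioc (0 : ℝ) 1, (w : ℂ)⁻¹ * (w : ℂ) ^ s = 1 / s := by
  have hs0 : s ≠ 0 := fun h => by simp [h] at hs
  have hpow := integral_cpow (a := 0) (b := 1) (r := s - 1) (.inl (by simpa using hs))
  rw [intervalIntegral.integral_of_le zero_le_one] at hpow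
  simp only [sub_add_cancel, Complex.ofReal_one, Complex.one_cpow, Complex.ofReal_zero,
    Complex.zero_cpow hs0, sub_zero] at hpow
  rw [← hpow]
  refine setIntegral_congr_fun measurableSet_Ioc fun w hw => ?_
  simp only [Complex.cpow_sub _ _ (Complex.ofReal_ne_zero.2 hw.1.ne'), Complex.cpow_one]
  ring

theorem integral_Gamma_sub_div_mul_cpow {p σ x : ℝ} (hσ : 0 < σ) (hσp : σ < p) (hx : 0 < x) :
    ∫ u : ℝ, Complex.Gamma (p - (σ + u * I)) / (σ + u * I) * (x : ℂ) ^ (σ + u * I : ℂ) =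
      2 * Real.pi * lowerGamma p x := by
  have hint : Integrable (fun w : ℝ => ‖(w : ℂ)⁻¹‖ * w ^ σ) (volume.restrict (Ioc 0 1)) := by
    have h := (intervalIntegrable_iff_integrableOn_Ioc_of_le zero_le_one).1
      (intervalIntegral.intervalIntegrable_rpow' (a := 0) (b := 1) (r := σ - 1) (by linarith))
    refine h.congr_fun (fun w hw => ?_) measurableSet_Ioc
    simp only [norm_inv, Complex.norm_real, Real.norm_of_nonneg hw.1.le,
      Real.rpow_sub_one hw.1.ne']
    ring
  calc _ = ∫ u : ℝ, Complex.Gamma (p - (σ + u * I)) * (x : ℂ) ^ (σ + u * I : ℂ) *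
          ∫ w in Ioc (0 : ℝ) 1, (w : ℂ)⁻¹ * (w : ℂ) ^ (σ + u * I : ℂ) := by
        congr with u
        rw [setIntegral_inv_mul_cpow (by simpa using hσ)]
        ring
    _ = ∫ w in Ioc (0 : ℝ) 1, (w : ℂ)⁻¹ *
          ∫ u : ℝ, Complex.Gamma (p - (σ + u * I)) * ((x * w : ℝ) : ℂ) ^ (σ + u * I : ℂ) := by
        refine integral_mul_cpow_mul_integral_cpow (integrable_Gamma_sub_line hσp) ?_
          (Measurable.aestronglyMeasurable (by fun_prop)) hint hx
        filter_upwards [ae_restrict_mem measurableSet_Ioc] with w hw using hw.1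
    _ = ∫ w in Ioc (0 : ℝ) 1,
          2 * Real.pi * x * (((x * w) ^ (p - 1) * Real.exp (-(x * w)) : ℝ) : ℂ) := by
        refine setIntegral_congr_fun measurableSet_Ioc fun w hw => ?_
        have hw0 : (w : ℂ) ≠ 0 := Complex.ofReal_ne_zero.2 hw.1.ne'
        have hx0 : (x : ℂ) ≠ 0 := Complex.ofReal_ne_zero.2 hx.ne'
        simp only [integral_Gamma_sub_mul_cpow hσp (mul_pos hx hw.1),
          Real.rpow_sub_one (mul_pos hx hw.1).ne']
        push_cast
        field_simp
    _ = _ := by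
        rw [integral_const_mul, integral_complex_ofReal, lowerGamma_eq_mul_setIntegral p hx.le]
        push_cast
        ring

/-- The factor `Γ(s + t) Γ(-t) Γ(p - s) / Γ(1 + s)` of the Mellin-Barnes integrand of `berFox p u v`
that does not depend on `u` and `v`. -/
def mellinBarnesKernel (p : ℝ) (s t : ℂ) : ℂ :=
  Complex.Gamma (s + t) * Complex.Gamma (-t) * (Complex.Gamma (p - s) / Complex.Gamma (1 + s))

theorem exists_norm_Gamma_mul_norm_Gamma_mul_pow_le {c d : ℝ} (hc : 0 < c) (hd : 0 < d)
    (m n : ℕ) : ∃ A : ℝ, ∀ u v : ℝ,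
      ‖Complex.Gamma (c + (u + v : ℝ) * I)‖ * ‖Complex.Gamma (d + v * I)‖ *
        ((1 + |u|) ^ m * (1 + |v|) ^ n) ≤ A := by
  obtain ⟨A, hA⟩ := exists_norm_Gamma_mul_pow_le hc m
  obtain ⟨B, hB⟩ := exists_norm_Gamma_mul_pow_le hd (m + n)
  have hA0 : 0 ≤ A := le_trans (by positivity) (hA 0)
  refine ⟨A * B, fun u v => ?_⟩
  have hu : 1 + |u| ≤ (1 + |u + v|) * (1 + |v|) := by
    have h := abs_sub (u + v) v
    rw [add_sub_cancel_right] at h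
    nlinarith [mul_nonneg (abs_nonneg (u + v)) (abs_nonneg v)]
  calc ‖Complex.Gamma (c + (u + v : ℝ) * I)‖ * ‖Complex.Gamma (d + v * I)‖ *
        ((1 + |u|) ^ m * (1 + |v|) ^ n)
      ≤ ‖Complex.Gamma (c + (u + v : ℝ) * I)‖ * ‖Complex.Gamma (d + v * I)‖ *
        (((1 + |u + v|) * (1 + |v|)) ^ m * (1 + |v|) ^ n) := by gcongr
    _ = (‖Complex.Gamma (c + (u + v : ℝ) * I)‖ * (1 + |u + v|) ^ m) *
        (‖Complex.Gamma (d + v * I)‖ * (1 + |v|) ^ (m + n)) := by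
      rw [mul_pow]
      ring
    _ ≤ A * B := by gcongr; exacts [hA (u + v), hB v]

theorem norm_mellinBarnesKernel_line (p σ τ u v : ℝ) :
    ‖mellinBarnesKernel p (σ + u * I) (τ + v * I)‖ =
      ‖Complex.Gamma ((σ + τ : ℝ) + (u + v : ℝ) * I)‖ * ‖Complex.Gamma ((-τ : ℝ) + v * I)‖ *
        (‖Complex.Gamma ((p - σ : ℝ) + u * I)‖ / ‖Complex.Gamma ((1 + σ : ℝ) + u * I)‖) := by
  have hconj (c w : ℝ) : ‖Complex.Gamma (c - w * I)‖ = ‖Complex.Gamma (c + w * I)‖ := by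
    rw [← Complex.norm_conj, ← Complex.Gamma_conj]
    simp
  simp only [← hconj (-τ), ← hconj (p - σ), mellinBarnesKernel, norm_mul, norm_div]
  push_cast
  ring_nf

section Kernel

variable {p σ τ : ℝ} (hτ : τ < 0) (hστ : 0 < σ + τ) (hσp : σ < p)

include hτ hστ hσp

theorem exists_norm_mellinBarnesKernel_le : ∃ A : ℝ, ∀ u v : ℝ,
    ‖mellinBarnesKernel p (σ + u * I) (τ + v * I)‖ ≤
      A * (((1 + |u|) ^ 2)⁻¹ * ((1 + |v|) ^ 2)⁻¹) := by
  obtain ⟨A, n, hA, hratio⟩ := exists_norm_Gamma_div_norm_Gamma_le (x := p - σ) (y := 1 + σ)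
    (by linarith) (by linarith)
  obtain ⟨B, hB⟩ := exists_norm_Gamma_mul_norm_Gamma_mul_pow_le hστ (neg_pos.2 hτ) (n + 2) 2
  refine ⟨A * B, fun u v => ?_⟩
  rw [norm_mellinBarnesKernel_line]
  set a := ‖Complex.Gamma ((σ + τ : ℝ) + (u + v : ℝ) * I)‖ *
    ‖Complex.Gamma ((-τ : ℝ) + v * I)‖
  calc _ ≤ a * (A * (1 + |u|) ^ n) := by gcongr; exact hratio u
    _ = A * (a * ((1 + |u|) ^ (n + 2) * (1 + |v|) ^ 2)) *
        (((1 + |u|) ^ 2)⁻¹ * ((1 + |v|) ^ 2)⁻¹) := by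
      field_simp
      ring
    _ ≤ A * B * (((1 + |u|) ^ 2)⁻¹ * ((1 + |v|) ^ 2)⁻¹) := by gcongr; exact hB u v

theorem continuous_mellinBarnesKernel :
    Continuous fun w : ℝ × ℝ => mellinBarnesKernel p (σ + w.1 * I) (τ + w.2 * I) := by
  have hσ : 0 < 1 + σ := by linarith
  refine ((continuous_Gamma_comp (by fun_prop) fun w => ?_).mul
    (continuous_Gamma_comp (by fun_prop) fun w => ?_)).mul
    ((continuous_Gamma_comp (by fun_prop) fun w => ?_).div
      (continuous_Gamma_comp (by fun_prop) fun w => ?_) fun w =>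
        Complex.Gamma_ne_zero_of_re_pos ?_)
  · simpa using hστ
  · simpa using hτ
  · simpa using hσp
  · simpa using hσ
  · simpa using hσ

theorem integrable_mellinBarnesKernel :
    Integrable fun w : ℝ × ℝ => mellinBarnesKernel p (σ + w.1 * I) (τ + w.2 * I) := by
  obtain ⟨A, hA⟩ := exists_norm_mellinBarnesKernel_le hτ hστ hσp
  exact ((integrable_inv_one_add_abs_sq.mul_prod integrable_inv_one_add_abs_sq).const_mul
    A).mono' (continuous_mellinBarnesKernel hτ hστ hσp).aestronglyMeasurable
    (.of_forall fun w => hA w.1 w.2)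

variable {x y : ℝ} (hx : 0 < x) (hy : 0 < y)

include hx hy

theorem integrable_mellinBarnesKernel_mul_cpow :
    Integrable fun w : ℝ × ℝ => mellinBarnesKernel p (σ + w.1 * I) (τ + w.2 * I) *
      ((x : ℂ) ^ (σ + w.1 * I : ℂ) * (y : ℂ) ^ (τ + w.2 * I : ℂ)) := by
  refine (integrable_mellinBarnesKernel hτ hστ hσp).mul_bdd (c := x ^ σ * y ^ τ)
    ((continuous_cpow_comp hx (by fun_prop)).mul
      (continuous_cpow_comp hy (by fun_prop))).aestronglyMeasurable
    (.of_forall fun w => ?_)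
  rw [norm_mul, norm_cpow_line hx, norm_cpow_line hy]

theorem integral_mellinBarnesKernel_mul_cpow :
    ∫ w : ℝ × ℝ, mellinBarnesKernel p (σ + w.1 * I) (τ + w.2 * I) *
        ((x : ℂ) ^ (σ + w.1 * I : ℂ) * (y : ℂ) ^ (τ + w.2 * I : ℂ)) =
      (2 * Real.pi) ^ 2 * lowerGamma p (x / (1 + y)) := by
  have hσ : 0 < σ := by linarith
  have hinner (u : ℝ) : ∫ v : ℝ, mellinBarnesKernel p (σ + u * I) (τ + v * I) *
        ((x : ℂ) ^ (σ + u * I : ℂ) * (y : ℂ) ^ (τ + v * I : ℂ)) =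
      2 * Real.pi * (Complex.Gamma (p - (σ + u * I)) / (σ + u * I) *
        ((x / (1 + y) : ℝ) : ℂ) ^ (σ + u * I : ℂ)) := by
    have hs := ofReal_add_mul_I_ne_zero hσ.ne' u
    have hΓ : Complex.Gamma (σ + u * I) ≠ 0 :=
      Complex.Gamma_ne_zero_of_re_pos (by simpa using hσ)
    calc _ = ∫ v : ℝ, Complex.Gamma (p - (σ + u * I)) / Complex.Gamma (1 + (σ + u * I)) *
            (x : ℂ) ^ (σ + u * I : ℂ) * (Complex.Gamma (σ + u * I + (τ + v * I)) *
              Complex.Gamma (-(τ + v * I)) * (y : ℂ) ^ (τ + v * I : ℂ)) := by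
          congr with v
          rw [mellinBarnesKernel]
          ring
      _ = _ := by
          rw [integral_const_mul,
            integral_Gamma_add_mul_Gamma_neg_mul_cpow hτ (by simpa using hστ) hy,
            add_comm (1 : ℂ), Complex.Gamma_add_one _ hs, div_eq_mul_one_div x,
            Complex.ofReal_mul, Complex.mul_cpow_ofReal_nonneg hx.le (by positivity)]
          field_simp
  have hint := integrable_mellinBarnesKernel_mul_cpow hτ hστ hσp hx hy
  rw [Measure.volume_eq_prod] at hint ⊢
  rw [integral_prod _ hint]
  simp only [hinner]
  rw [integral_const_mul, integral_Gamma_sub_div_mul_cpow hσ hσp (by positivity)]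
  ring

theorem integral_mellinBarnesKernel_mul_integral_cpow {Ω₁ Ω₂ : Type*} [MeasurableSpace Ω₁]
    [MeasurableSpace Ω₂] {μ₁ : Measure Ω₁} {μ₂ : Measure Ω₂} [SFinite μ₁] [SFinite μ₂]
    {X : Ω₁ → ℝ} {Y : Ω₂ → ℝ} (hX : Measurable X) (hY : Measurable Y)
    (hXpos : ∀ᵐ ω ∂μ₁, 0 < X ω) (hYpos : ∀ᵐ ω ∂μ₂, 0 < Y ω)
    (hXσ : Integrable (fun ω => X ω ^ σ) μ₁) (hYτ : Integrable (fun ω => Y ω ^ τ) μ₂) :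
    ∫ w : ℝ × ℝ, mellinBarnesKernel p (σ + w.1 * I) (τ + w.2 * I) *
        ((x : ℂ) ^ (σ + w.1 * I : ℂ) * (y : ℂ) ^ (τ + w.2 * I : ℂ)) *
        ((∫ ω, (X ω : ℂ) ^ (σ + w.1 * I : ℂ) ∂μ₁) * ∫ ω, (Y ω : ℂ) ^ (τ + w.2 * I : ℂ) ∂μ₂) =
      (2 * Real.pi) ^ 2 *
        ((∫ ω, lowerGamma p (x * X ω.1 / (1 + y * Y ω.2)) ∂μ₁.prod μ₂ : ℝ) : ℂ) := by
  have hpos : ∀ᵐ ω ∂μ₁.prod μ₂, 0 < X ω.1 ∧ 0 < Y ω.2 :=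
    (Measure.quasiMeasurePreserving_fst.ae hXpos).and
      (Measure.quasiMeasurePreserving_snd.ae hYpos)
  simp only [← integral_prod_mul]
  rw [integral_mul_integral_swap (integrable_mellinBarnesKernel_mul_cpow hτ hστ hσp hx hy)
    (hXσ.mul_prod hYτ) (Measurable.aestronglyMeasurable (by fun_prop)), ← integral_complex_ofReal,
    ← integral_const_mul]
  · refine integral_congr_ae ?_
    filter_upwards [hpos] with ω ⟨hω₁, hω₂⟩
    rw [← integral_mellinBarnesKernel_mul_cpow hτ hστ hσp (mul_pos hx hω₁) (mul_pos hy hω₂)]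
    congr with w
    rw [Complex.ofReal_mul, Complex.ofReal_mul, Complex.mul_cpow_ofReal_nonneg hx.le hω₁.le,
      Complex.mul_cpow_ofReal_nonneg hy.le hω₂.le]
    ring
  · filter_upwards [hpos] with ω ⟨hω₁, hω₂⟩ w
    rw [norm_mul, norm_cpow_line hω₁, norm_cpow_line hω₂]

end Kernel

section GammaMeasure

variable {a : ℝ}

theorem gammaMeasure_one_eq_withDensity (a : ℝ) : gammaMeasure a 1 =
    (volume.restrict (Ioi 0)).withDensity
      fun g => ENNReal.ofReal (Real.exp (-g) * g ^ (a - 1) / Real.Gamma a) := by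
  rw [gammaMeasure, ← withDensity_indicator measurableSet_Ioi]
  refine withDensity_congr_ae ?_
  filter_upwards [Measure.ae_ne volume (0 : ℝ)] with g hg
  rcases hg.lt_or_gt with hg | hg
  · rw [gammaPDF_of_neg hg, indicator_of_notMem (notMem_Ioi.2 hg.le)]
  · rw [gammaPDF_of_nonneg hg.le, indicator_of_mem (mem_Ioi.2 hg), Real.one_rpow, one_mul]
    congr 1
    ring

theorem ae_pos_gammaMeasure_one (a : ℝ) : ∀ᵐ g ∂gammaMeasure a 1, 0 < g := by
  rw [gammaMeasure_one_eq_withDensity]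
  exact (withDensity_absolutelyContinuous _ _).ae_le (ae_restrict_mem measurableSet_Ioi)

variable (ha : 0 < a)

include ha

theorem toReal_ofReal_gammaDensity {g : ℝ} (hg : 0 < g) :
    (ENNReal.ofReal (Real.exp (-g) * g ^ (a - 1) / Real.Gamma a)).toReal =
      Real.exp (-g) * g ^ (a - 1) / Real.Gamma a := by
  have := Real.Gamma_pos_of_pos ha
  exact ENNReal.toReal_ofReal (by positivity)

theorem integral_cpow_gammaMeasure_one {z : ℂ} (hz : 0 < (a + z).re) :
    ∫ g, (g : ℂ) ^ z ∂gammaMeasure a 1 = Complex.Gamma (a + z) / Real.Gamma a := by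
  rw [gammaMeasure_one_eq_withDensity, integral_withDensity_eq_integral_toReal_smul (by fun_prop)
    (by simp), Complex.Gamma_eq_integral hz, Complex.GammaIntegral, ← integral_div]
  refine setIntegral_congr_fun measurableSet_Ioi fun g (hg : 0 < g) => ?_
  simp only [toReal_ofReal_gammaDensity ha hg, Complex.real_smul, add_sub_right_comm (a : ℂ),
    Complex.cpow_add _ _ (Complex.ofReal_ne_zero.2 hg.ne')]
  push_cast [Complex.ofReal_cpow hg.le]
  ring

theorem integrable_rpow_gammaMeasure_one {r : ℝ} (hr : 0 < a + r) :
    Integrable (fun g => g ^ r) (gammaMeasure a 1) := by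
  rw [gammaMeasure_one_eq_withDensity,
    integrable_withDensity_iff_integrable_smul' (by fun_prop) (by simp)]
  refine IntegrableOn.congr_fun ((Real.GammaIntegral_convergent hr).div_const (Real.Gamma a))
    (fun g (hg : 0 < g) => ?_) measurableSet_Ioi
  simp only [toReal_ofReal_gammaDensity ha hg, smul_eq_mul, add_sub_right_comm a,
    Real.rpow_add hg]
  ring

end GammaMeasure

theorem integral_cpow_rpow_gammaMeasure_one {a α : ℝ} (ha : 0 < a) {s : ℂ}
    (hs : 0 < (a + α * s).re) :
    ∫ g : ℝ, ((g ^ α : ℝ) : ℂ) ^ s ∂gammaMeasure a 1 =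
      Complex.Gamma (a + α * s) / Real.Gamma a := by
  rw [← integral_cpow_gammaMeasure_one ha hs]
  refine integral_congr_ae ?_
  filter_upwards [ae_pos_gammaMeasure_one a] with g hg
  rw [Complex.cpow_mul_ofReal_nonneg hg.le]

theorem integrable_rpow_rpow_gammaMeasure_one {a α r : ℝ} (ha : 0 < a) (hr : 0 < a + α * r) :
    Integrable (fun g : ℝ => (g ^ α) ^ r) (gammaMeasure a 1) := by
  refine (integrable_rpow_gammaMeasure_one ha hr).congr ?_
  filter_upwards [ae_pos_gammaMeasure_one a] with g hg
  rw [Real.rpow_mul hg.le]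

section GammaMoments

variable {p a₁ a₂ α β σ τ x y : ℝ} (ha₁ : 0 < a₁) (ha₂ : 0 < a₂) (hα : 0 ≤ α) (hβ : 0 ≤ β)
  (hτ : τ < 0) (hστ : 0 < σ + τ) (hσp : σ < p) (hx : 0 < x) (hy : 0 < y)

include ha₁ ha₂ hα hβ hτ hστ hσp hx hy

theorem integral_mellinBarnesKernel_mul_Gamma_mul_Gamma :
    ∫ w : ℝ × ℝ, mellinBarnesKernel p (σ + w.1 * I) (τ + w.2 * I) *
        ((x : ℂ) ^ (σ + w.1 * I : ℂ) * (y : ℂ) ^ (τ + w.2 * I : ℂ)) *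
        (Complex.Gamma (a₁ + α * (σ + w.1 * I)) * Complex.Gamma (a₂ - β * (τ + w.2 * I))) =
      (2 * Real.pi) ^ 2 * (Real.Gamma a₁ * Real.Gamma a₂ *
        ∫ g, lowerGamma p (x * g.1 ^ α / (1 + y * g.2 ^ (-β)))
          ∂(gammaMeasure a₁ 1).prod (gammaMeasure a₂ 1) : ℝ) := by
  have := isProbabilityMeasure_gammaMeasure ha₁ one_pos
  have := isProbabilityMeasure_gammaMeasure ha₂ one_pos
  have hασ : 0 < a₁ + α * σ := by nlinarith
  have hβτ : 0 < a₂ + -β * τ := by nlinarith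
  have hΓ₁ : (Real.Gamma a₁ : ℂ) ≠ 0 := by exact_mod_cast (Real.Gamma_pos_of_pos ha₁).ne'
  have hΓ₂ : (Real.Gamma a₂ : ℂ) ≠ 0 := by exact_mod_cast (Real.Gamma_pos_of_pos ha₂).ne'
  have hpos (a r : ℝ) : ∀ᵐ g ∂gammaMeasure a 1, 0 < g ^ r := by
    filter_upwards [ae_pos_gammaMeasure_one a] with g hg using Real.rpow_pos_of_pos hg r
  have hmoments := integral_mellinBarnesKernel_mul_integral_cpow hτ hστ hσp hx hy
    (X := fun g => g ^ α) (Y := fun g => g ^ (-β)) (measurable_id.pow_const α)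
    (measurable_id.pow_const (-β)) (hpos a₁ α) (hpos a₂ (-β))
    (integrable_rpow_rpow_gammaMeasure_one ha₁ hασ)
    (integrable_rpow_rpow_gammaMeasure_one ha₂ hβτ)
  rw [Complex.ofReal_mul, mul_left_comm, ← hmoments, ← integral_const_mul]
  congr with w
  rw [integral_cpow_rpow_gammaMeasure_one ha₁ (by simpa using hασ),
    integral_cpow_rpow_gammaMeasure_one ha₂ (by simpa using hβτ)]
  push_cast
  field_simp
  ring_nf

theorem integrable_mellinBarnesKernel_mul_Gamma_mul_Gamma :
    Integrable fun w : ℝ × ℝ => mellinBarnesKernel p (σ + w.1 * I) (τ + w.2 * I) *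
        ((x : ℂ) ^ (σ + w.1 * I : ℂ) * (y : ℂ) ^ (τ + w.2 * I : ℂ)) *
        (Complex.Gamma (a₁ + α * (σ + w.1 * I)) * Complex.Gamma (a₂ - β * (τ + w.2 * I))) := by
  have hασ : 0 < a₁ + α * σ := by nlinarith
  have hβτ : 0 < a₂ - β * τ := by nlinarith
  refine (integrable_mellinBarnesKernel_mul_cpow hτ hστ hσp hx hy).mul_bdd
    (c := Real.Gamma (a₁ + α * σ) * Real.Gamma (a₂ - β * τ))
    ((continuous_Gamma_comp (by fun_prop) fun w => by simpa using hασ).mul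
      (continuous_Gamma_comp (by fun_prop) fun w => by simpa using hβτ)).aestronglyMeasurable
    (.of_forall fun w => ?_)
  have := (Real.Gamma_pos_of_pos hασ).le
  rw [norm_mul]
  gcongr
  · exact (norm_Gamma_le (by simpa using hασ)).trans_eq (by simp)
  · exact (norm_Gamma_le (by simpa using hβτ)).trans_eq (by simp)

end GammaMoments

namespace FoxData

variable {D : FoxData} {x y : ℝ} {v : ℂ}

theorem foxH_eq_of_contourIntegral_eq (hD : ∃ σ τ : ℝ, D.Separates σ τ)
    (hv : ∀ σ τ : ℝ, D.Separates σ τ → D.contourIntegral x y σ τ = v) : D.foxH x y = v := by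
  have hD' : ∃ c : ℝ × ℝ, D.Separates c.1 c.2 := Prod.exists.2 hD
  rw [foxH, dif_pos hD']
  exact hv _ _ hD'.choose_spec

theorem wellDefinedAt_of_contourIntegral_eq (hD : ∃ σ τ : ℝ, D.Separates σ τ)
    (hint : ∀ σ τ : ℝ, D.Separates σ τ → Integrable (D.lineIntegrand x y σ τ))
    (hv : ∀ σ τ : ℝ, D.Separates σ τ → D.contourIntegral x y σ τ = v) : D.WellDefinedAt x y :=
  ⟨hD, fun σ τ h => ⟨hint σ τ h, (hv σ τ h).trans (foxH_eq_of_contourIntegral_eq hD hv).symm⟩⟩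

end FoxData

section berFox

variable {p a₁ a₂ α β x y σ τ : ℝ}

theorem berFox_lineIntegrand (w : ℝ × ℝ) :
    (berFox p (1 - a₁, α) (a₂, β)).lineIntegrand x y σ τ w =
      mellinBarnesKernel p (σ + w.1 * I) (τ + w.2 * I) *
        ((x : ℂ) ^ (σ + w.1 * I : ℂ) * (y : ℂ) ^ (τ + w.2 * I : ℂ)) *
        (Complex.Gamma (a₁ + α * (σ + w.1 * I)) * Complex.Gamma (a₂ - β * (τ + w.2 * I))) := by
  simp only [FoxData.lineIntegrand, FoxData.integrand, FoxData.coupled, FoxFactor.eval, berFox,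
    mellinBarnesKernel, List.take_succ_cons, List.take_zero, List.drop_succ_cons, List.drop_zero,
    List.map_cons, List.map_nil, List.prod_cons, List.prod_nil, List.take_nil, List.drop_nil]
  push_cast
  simp only [sub_self, zero_add, one_mul, mul_one, div_one, sub_zero, zero_sub, sub_sub_cancel]
  ring

variable (ha₁ : 0 < a₁) (ha₂ : 0 < a₂) (hα : 0 ≤ α) (hβ : 0 ≤ β)

include ha₁ ha₂ hα hβ

theorem berFox_separates_iff :
    (berFox p (1 - a₁, α) (a₂, β)).Separates σ τ ↔ τ < 0 ∧ 0 < σ + τ ∧ σ < p := by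
  simp only [FoxData.Separates, berFox, List.take_succ_cons, List.take_zero, List.mem_cons,
    List.not_mem_nil, or_false, forall_eq_or_imp, forall_eq, IsEmpty.forall_iff, implies_true]
  constructor
  · rintro ⟨hστ, hσp, -, ⟨hτ, -⟩, -⟩
    refine ⟨?_, ?_, ?_⟩ <;> linarith
  · rintro ⟨hτ, hστ, hσp⟩
    have hασ : 0 ≤ α * σ := mul_nonneg hα (by linarith)
    have hβτ : 0 ≤ β * -τ := mul_nonneg hβ (by linarith)
    refine ⟨?_, ?_, ?_, ⟨?_, ?_⟩, trivial⟩ <;> linarith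

theorem berFox_exists_separates (hp : 0 < p) :
    ∃ σ τ : ℝ, (berFox p (1 - a₁, α) (a₂, β)).Separates σ τ := by
  refine ⟨p / 2, -(p / 4), (berFox_separates_iff ha₁ ha₂ hα hβ).2 ⟨?_, ?_, ?_⟩⟩ <;> linarith

variable (hx : 0 < x) (hy : 0 < y)

include hx hy

theorem berFox_integrable_lineIntegrand (h : (berFox p (1 - a₁, α) (a₂, β)).Separates σ τ) :
    Integrable ((berFox p (1 - a₁, α) (a₂, β)).lineIntegrand x y σ τ) := by
  obtain ⟨hτ, hστ, hσp⟩ := (berFox_separates_iff ha₁ ha₂ hα hβ).1 h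
  simpa only [funext berFox_lineIntegrand] using
    integrable_mellinBarnesKernel_mul_Gamma_mul_Gamma ha₁ ha₂ hα hβ hτ hστ hσp hx hy

theorem berFox_contourIntegral (h : (berFox p (1 - a₁, α) (a₂, β)).Separates σ τ) :
    (berFox p (1 - a₁, α) (a₂, β)).contourIntegral x y σ τ =
      (Real.Gamma a₁ * Real.Gamma a₂ *
        ∫ g, lowerGamma p (x * g.1 ^ α / (1 + y * g.2 ^ (-β)))
          ∂(gammaMeasure a₁ 1).prod (gammaMeasure a₂ 1) : ℝ) := by
  obtain ⟨hτ, hστ, hσp⟩ := (berFox_separates_iff ha₁ ha₂ hα hβ).1 h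
  have hπ : (Real.pi : ℂ) ≠ 0 := by exact_mod_cast Real.pi_ne_zero
  simp only [FoxData.contourIntegral, berFox_lineIntegrand,
    integral_mellinBarnesKernel_mul_Gamma_mul_Gamma ha₁ ha₂ hα hβ hτ hστ hσp hx hy]
  field_simp [Complex.I_ne_zero]

theorem berFox_foxH (hp : 0 < p) :
    (berFox p (1 - a₁, α) (a₂, β)).foxH x y =
      (Real.Gamma a₁ * Real.Gamma a₂ *
        ∫ g, lowerGamma p (x * g.1 ^ α / (1 + y * g.2 ^ (-β)))
          ∂(gammaMeasure a₁ 1).prod (gammaMeasure a₂ 1) : ℝ) :=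
  FoxData.foxH_eq_of_contourIntegral_eq (berFox_exists_separates ha₁ ha₂ hα hβ hp) fun _ _ =>
    berFox_contourIntegral ha₁ ha₂ hα hβ hx hy

theorem berFox_wellDefinedAt (hp : 0 < p) :
    (berFox p (1 - a₁, α) (a₂, β)).WellDefinedAt x y :=
  FoxData.wellDefinedAt_of_contourIntegral_eq (berFox_exists_separates ha₁ ha₂ hα hβ hp)
    (fun _ _ => berFox_integrable_lineIntegrand ha₁ ha₂ hα hβ hx hy) fun _ _ =>
    berFox_contourIntegral ha₁ ha₂ hα hβ hx hy

end berFox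

section GenGamma

/-- The generalized Gamma distribution with shape parameters `a`, `c` and scale `b`, encoded as the
law of `b G ^ (1 / c)` for a Gamma variable `G` of shape `a` and rate `1`. -/
def genGammaMeasure (a b c : ℝ) : Measure ℝ :=
  (gammaMeasure a 1).map fun g => b * g ^ (1 / c)

variable {a b c : ℝ}

theorem isProbabilityMeasure_genGammaMeasure (ha : 0 < a) :
    IsProbabilityMeasure (genGammaMeasure a b c) :=
  have := isProbabilityMeasure_gammaMeasure ha one_pos
  Measure.isProbabilityMeasure_map (Measurable.aemeasurable (by fun_prop))

variable (hb : 0 < b) (hc : 0 < c)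

include hb hc

theorem image_div_rpow (s : Set ℝ) : (fun x => (x / b) ^ c) '' (s ∩ Ioi 0) =
    (fun g => b * g ^ (1 / c)) ⁻¹' s ∩ Ioi 0 := by
  refine Set.ext fun g => ⟨?_, fun ⟨hgs, (hg : 0 < g)⟩ => ?_⟩
  · rintro ⟨x, ⟨hxs, hx : 0 < x⟩, rfl⟩
    have hbx : b * ((x / b) ^ c) ^ (1 / c) = x := by
      rw [one_div, Real.rpow_rpow_inv (by positivity) hc.ne', mul_div_cancel₀ _ hb.ne']
    exact ⟨by simpa only [mem_preimage, hbx] using hxs, mem_Ioi.2 (by positivity)⟩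
  · refine ⟨_, ⟨hgs, mem_Ioi.2 (by positivity)⟩, ?_⟩
    simp only
    rw [mul_div_cancel_left₀ _ hb.ne', one_div, Real.rpow_inv_rpow hg.le hc.ne']

theorem injOn_div_rpow : InjOn (fun x => (x / b) ^ c) (Ioi 0) :=
  fun x (hx : 0 < x) y (hy : 0 < y) h => by
    rwa [Real.rpow_left_inj (by positivity) (by positivity) hc.ne', div_left_inj' hb.ne'] at h

theorem genGammaMeasure_eq_withDensity (ha : 0 < a) : genGammaMeasure a b c =
    (volume.restrict (Ioi 0)).withDensity fun x => ENNReal.ofReal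
      (c * x ^ (a * c - 1) / (b ^ (a * c) * Real.Gamma a) * Real.exp (-(x / b) ^ c)) := by
  have hderiv (x : ℝ) (hx : 0 < x) :
      HasDerivAt (fun x => (x / b) ^ c) (1 / b * c * (x / b) ^ (c - 1)) x :=
    ((hasDerivAt_id x).div_const b).rpow_const (.inl (by positivity))
  ext s hs
  rw [genGammaMeasure, Measure.map_apply (by fun_prop) hs, gammaMeasure_one_eq_withDensity,
    withDensity_apply' _ _, withDensity_apply _ hs, Measure.restrict_restrict hs,
    Measure.restrict_restrict (hs.preimage (by fun_prop)), ← image_div_rpow hb hc,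
    lintegral_image_eq_lintegral_abs_deriv_mul (hs.inter measurableSet_Ioi)
      (fun x hx => (hderiv x hx.2).hasDerivWithinAt)
      ((injOn_div_rpow hb hc).mono inter_subset_right)]
  refine setLIntegral_congr_fun (hs.inter measurableSet_Ioi) fun x ⟨_, (hx : 0 < x)⟩ => ?_
  have := Real.Gamma_pos_of_pos ha
  have hpow : (x / b) ^ (c - 1) * ((x / b) ^ c) ^ (a - 1) = x ^ (a * c - 1) * b / b ^ (a * c) := by
    rw [← Real.rpow_mul (by positivity), ← Real.rpow_add (by positivity),
      show c - 1 + c * (a - 1) = a * c - 1 by ring, Real.div_rpow hx.le hb.le,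
      Real.rpow_sub_one hb.ne', div_div_eq_mul_div]
  rw [← ENNReal.ofReal_mul (abs_nonneg _), abs_of_pos (by positivity)]
  congr 1
  calc _ = c / b * ((x / b) ^ (c - 1) * ((x / b) ^ c) ^ (a - 1)) / Real.Gamma a *
        Real.exp (-(x / b) ^ c) := by ring
    _ = _ := by
      rw [hpow]
      field_simp

end GenGamma

section EGG

variable {ω lam a b c : ℝ}

theorem eggMeasure_eq_add_smul (hω₀ : 0 ≤ ω) (hω₁ : ω ≤ 1) (hlam : 0 < lam) (ha : 0 < a)
    (hb : 0 < b) (hc : 0 < c) :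
    eggMeasure ω lam a b c = ENNReal.ofReal ω • genGammaMeasure 1 lam 1 +
      ENNReal.ofReal (1 - ω) • genGammaMeasure a b c := by
  rw [genGammaMeasure_eq_withDensity hlam one_pos one_pos,
    genGammaMeasure_eq_withDensity hb hc ha, ← withDensity_smul _ (by fun_prop),
    ← withDensity_smul _ (by fun_prop), ← withDensity_add_left (by fun_prop), eggMeasure]
  refine withDensity_congr_ae ?_
  filter_upwards [ae_restrict_mem measurableSet_Ioi] with x (hx : 0 < x)
  have := Real.Gamma_pos_of_pos ha
  have hω' := sub_nonneg.2 hω₁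
  simp only [Pi.add_apply, Pi.smul_apply, smul_eq_mul, eggPDF, Real.Gamma_one]
  rw [← ENNReal.ofReal_mul hω₀, ← ENNReal.ofReal_mul hω',
    ← ENNReal.ofReal_add (by positivity) (by positivity)]
  congr 1
  simp only [mul_one, sub_self, Real.rpow_zero, Real.rpow_one]
  ring

theorem eggMeasure_absolutelyContinuous :
    eggMeasure ω lam a b c ≪ volume.restrict (Ioi 0) :=
  withDensity_absolutelyContinuous _ _

end EGG

section Mixture

variable {X Y E : Type*} [MeasurableSpace X] [MeasurableSpace Y] [NormedAddCommGroup E]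
  {s t : ℝ}

theorem integrable_mixture {μ μ' : Measure X} {F : X → E} (h : Integrable F μ)
    (h' : Integrable F μ') (s : ℝ) :
    Integrable F (ENNReal.ofReal s • μ + ENNReal.ofReal (1 - s) • μ') :=
  (h.smul_measure ENNReal.ofReal_ne_top).add_measure (h'.smul_measure ENNReal.ofReal_ne_top)

variable [NormedSpace ℝ E]

theorem integral_mixture {μ μ' : Measure X} {F : X → E} (hs : s ∈ Icc 0 1) (h : Integrable F μ)
    (h' : Integrable F μ') :
    ∫ x, F x ∂(ENNReal.ofReal s • μ + ENNReal.ofReal (1 - s) • μ') =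
      s • ∫ x, F x ∂μ + (1 - s) • ∫ x, F x ∂μ' := by
  rw [integral_add_measure (h.smul_measure ENNReal.ofReal_ne_top)
    (h'.smul_measure ENNReal.ofReal_ne_top), integral_smul_measure, integral_smul_measure,
    ENNReal.toReal_ofReal hs.1, ENNReal.toReal_ofReal (sub_nonneg.2 hs.2)]

theorem integral_prod_mixture {μ μ' : Measure X} {ν ν' : Measure Y} [SFinite μ] [SFinite μ']
    [SFinite ν] [SFinite ν'] (hs : s ∈ Icc 0 1) (ht : t ∈ Icc 0 1) {F : X × Y → E}
    (h₁ : Integrable F (μ.prod ν)) (h₂ : Integrable F (μ.prod ν'))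
    (h₃ : Integrable F (μ'.prod ν)) (h₄ : Integrable F (μ'.prod ν')) :
    ∫ z, F z ∂(ENNReal.ofReal s • μ + ENNReal.ofReal (1 - s) • μ').prod
        (ENNReal.ofReal t • ν + ENNReal.ofReal (1 - t) • ν') =
      s • (t • ∫ z, F z ∂μ.prod ν + (1 - t) • ∫ z, F z ∂μ.prod ν') +
        (1 - s) • (t • ∫ z, F z ∂μ'.prod ν + (1 - t) • ∫ z, F z ∂μ'.prod ν') := by
  rw [Measure.add_prod, Measure.prod_smul_left, Measure.prod_smul_left, Measure.prod_add,
    Measure.prod_add]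
  simp only [Measure.prod_smul_right]
  rw [integral_mixture hs (integrable_mixture h₁ h₂ t) (integrable_mixture h₃ h₄ t),
    integral_mixture ht h₁ h₂, integral_mixture ht h₃ h₄]

end Mixture

section Density

theorem map_prod_absolutelyContinuous {X Y Z : Type*} [MeasurableSpace X] [MeasurableSpace Y]
    [MeasurableSpace Z] {μ : Measure X} {ν : Measure Y} {ρ : Measure Z} [SFinite μ] [SFinite ν]
    {f : X × Y → Z} (hf : Measurable f) (h : ∀ᵐ y ∂ν, μ.map (fun x => f (x, y)) ≪ ρ) :
    (μ.prod ν).map f ≪ ρ := by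
  refine Measure.AbsolutelyContinuous.mk fun s hs hρs => ?_
  rw [Measure.map_apply hf hs, ← Measure.prod_swap, Measure.map_apply measurable_swap (hf hs)]
  refine Measure.measure_prod_null_of_ae_null (measurable_swap (hf hs)) ?_
  filter_upwards [h] with y hy
  have hsec := hy hρs
  rwa [Measure.map_apply (by fun_prop) hs] at hsec

theorem map_mul_pow_restrict_absolutelyContinuous {k : ℝ} (hk : k ≠ 0) {r : ℕ} (hr : r ≠ 0) :
    (volume.restrict (Ioi 0)).map (fun x : ℝ => k * x ^ r) ≪ volume := by
  refine Measure.AbsolutelyContinuous.mk fun s hs hvol => ?_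
  rw [Measure.map_apply (by fun_prop) hs, Measure.restrict_apply (hs.preimage (by fun_prop))]
  have hroot : DifferentiableOn ℝ (fun z : ℝ => (z / k) ^ ((r : ℝ)⁻¹)) (s ∩ {0}ᶜ) :=
    fun z ⟨_, (hz : z ≠ 0)⟩ => ((differentiableAt_id.div_const k).rpow_const
      (.inl (div_ne_zero hz hk))).differentiableWithinAt
  refine measure_mono_null ?_ (addHaar_image_eq_zero_of_differentiableOn_of_addHaar_eq_zero volume
    hroot (measure_mono_null inter_subset_left hvol))
  rintro x ⟨hxs, hx : 0 < x⟩
  refine ⟨k * x ^ r, ⟨hxs, mul_ne_zero hk (pow_ne_zero r hx.ne')⟩, ?_⟩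
  simp only
  rw [mul_div_cancel_left₀ _ hk, Real.pow_rpow_inv_natCast hx.le hr]

end Density

section PDF

variable {Ω E : Type*} [MeasurableSpace Ω] {P : Measure Ω} {X : Ω → E} {s : Set E} {g : E → ℝ}

theorem indicator_comp_ae_eq (hX : ∀ᵐ w ∂P, X w ∈ s) :
    (fun w => s.indicator g (X w)) =ᵐ[P] fun w => g (X w) := by
  filter_upwards [hX] with w hw using indicator_of_mem hw g

variable [MeasurableSpace E] {ρ : Measure E}

theorem indicator_mul_pdf :
    (s.indicator fun x => g x * (pdf X P ρ x).toReal) =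
      fun x => (pdf X P ρ x).toReal • s.indicator g x := by
  ext x
  simp only [smul_eq_mul, mul_comm _ (s.indicator g x), indicator_mul_left]

variable [IsFiniteMeasure P] [HasPDF X P ρ] (hs : MeasurableSet s) (hX : ∀ᵐ w ∂P, X w ∈ s)
  (hg : AEStronglyMeasurable g (ρ.restrict s))

include hs hX hg

theorem integrableOn_mul_pdf_iff :
    IntegrableOn (fun x => g x * (pdf X P ρ x).toReal) s ρ ↔ Integrable (fun w => g (X w)) P := by
  rw [← integrable_indicator_iff hs, indicator_mul_pdf,
    pdf.integrable_pdf_smul_iff ((aestronglyMeasurable_indicator_iff hs).2 hg),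
    integrable_congr (indicator_comp_ae_eq hX)]

theorem setIntegral_mul_pdf :
    ∫ x in s, g x * (pdf X P ρ x).toReal ∂ρ = ∫ w, g (X w) ∂P := by
  rw [← integral_indicator hs, indicator_mul_pdf,
    pdf.integral_pdf_smul ((aestronglyMeasurable_indicator_iff hs).2 hg),
    integral_congr_ae (indicator_comp_ae_eq hX)]

end PDF

section IncompleteGamma

variable {p : ℝ}

theorem integrableOn_rpow_mul_exp_neg (hp : 0 < p) :
    IntegrableOn (fun t : ℝ => t ^ (p - 1) * Real.exp (-t)) (Ioi 0) := by
  simpa only [mul_comm] using Real.GammaIntegral_convergent hp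

theorem upperGamma_add_lowerGamma (hp : 0 < p) {x : ℝ} (hx : 0 ≤ x) :
    upperGamma p x + lowerGamma p x = Real.Gamma p := by
  have hint := integrableOn_rpow_mul_exp_neg hp
  simp only [upperGamma, lowerGamma, Real.Gamma_eq_integral hp, mul_comm (Real.exp _)]
  rw [← Ioc_union_Ioi_eq_Ioi hx, setIntegral_union (Ioc_disjoint_Ioi le_rfl) measurableSet_Ioi
    (hint.mono_set Ioc_subset_Ioi_self) (hint.mono_set (Ioi_subset_Ioi hx)), add_comm]

theorem lowerGamma_mono (hp : 0 < p) : Monotone (lowerGamma p) := fun _ _ hxy =>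
  setIntegral_mono_set ((integrableOn_rpow_mul_exp_neg hp).mono_set Ioc_subset_Ioi_self)
    ((ae_restrict_mem measurableSet_Ioc).mono fun _ ht =>
      mul_nonneg (Real.rpow_nonneg ht.1.le _) (Real.exp_nonneg _))
    (Ioc_subset_Ioc_right hxy).eventuallyLE

theorem lowerGamma_nonneg (p x : ℝ) : 0 ≤ lowerGamma p x :=
  setIntegral_nonneg measurableSet_Ioc fun t ht => by have := ht.1; positivity

theorem norm_lowerGamma_le (hp : 0 < p) (x : ℝ) : ‖lowerGamma p x‖ ≤ Real.Gamma p := by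
  have hupper : 0 ≤ upperGamma p (max x 0) :=
    setIntegral_nonneg measurableSet_Ioi fun t ht => by
      have := (le_max_right x 0).trans_lt ht
      positivity
  rw [Real.norm_of_nonneg (lowerGamma_nonneg p x),
    ← upperGamma_add_lowerGamma hp (le_max_right x 0)]
  exact (lowerGamma_mono hp (le_max_left x 0)).trans (le_add_of_nonneg_left hupper)

theorem integrable_lowerGamma_comp {Ω : Type*} [MeasurableSpace Ω] {P : Measure Ω}
    [IsFiniteMeasure P] (hp : 0 < p) {f : Ω → ℝ} (hf : AEMeasurable f P) :
    Integrable (fun w => lowerGamma p (f w)) P :=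
  .of_bound ((lowerGamma_mono hp).measurable.comp_aemeasurable hf).aestronglyMeasurable _
    (.of_forall fun _ => norm_lowerGamma_le hp _)

end IncompleteGamma

section AverageBER

variable {Ω : Type*} [MeasurableSpace Ω] {P : Measure Ω} {γ : Ω → ℝ} {p : ℝ} (hp : 0 < p)
  (hγ : ∀ᵐ w ∂P, 0 < γ w)

include hp

theorem aestronglyMeasurable_upperGamma_mul {q : ℝ} (hq : 0 ≤ q) :
    AEStronglyMeasurable (fun x => upperGamma p (q * x)) (volume.restrict (Ioi 0)) := by
  refine AEStronglyMeasurable.congr (f := fun x => Real.Gamma p - lowerGamma p (q * x))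
    (measurable_const.sub ((lowerGamma_mono hp).measurable.comp
      (measurable_const_mul q))).aestronglyMeasurable ?_
  filter_upwards [ae_restrict_mem measurableSet_Ioi] with x (hx : 0 < x)
  rw [← upperGamma_add_lowerGamma hp (mul_nonneg hq hx.le), add_sub_cancel_right]

include hγ

theorem upperGamma_comp_ae_eq {q : ℝ} (hq : 0 ≤ q) : (fun w => upperGamma p (q * γ w)) =ᵐ[P]
    fun w => Real.Gamma p - lowerGamma p (q * γ w) := by
  filter_upwards [hγ] with w hw
  rw [← upperGamma_add_lowerGamma hp (mul_nonneg hq hw.le), add_sub_cancel_right]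

variable [IsProbabilityMeasure P] [HasPDF γ P volume]

theorem integrableOn_upperGamma_mul_pdf {q : ℝ} (hq : 0 ≤ q) :
    IntegrableOn (fun x => upperGamma p (q * x) * (pdf γ P volume x).toReal) (Ioi 0) := by
  have hγm : AEMeasurable γ P := HasPDF.aemeasurable γ P volume
  rw [integrableOn_mul_pdf_iff measurableSet_Ioi hγ (aestronglyMeasurable_upperGamma_mul hp hq),
    integrable_congr (upperGamma_comp_ae_eq hp hγ hq)]
  exact (integrable_const _).sub (integrable_lowerGamma_comp hp (hγm.const_mul q))

theorem setIntegral_upperGamma_mul_pdf {q : ℝ} (hq : 0 ≤ q) :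
    ∫ x in Ioi 0, upperGamma p (q * x) * (pdf γ P volume x).toReal =
      Real.Gamma p - ∫ w, lowerGamma p (q * γ w) ∂P := by
  have hγm : AEMeasurable γ P := HasPDF.aemeasurable γ P volume
  rw [setIntegral_mul_pdf measurableSet_Ioi hγ (aestronglyMeasurable_upperGamma_mul hp hq),
    integral_congr_ae (upperGamma_comp_ae_eq hp hγ hq),
    integral_sub (integrable_const _) (integrable_lowerGamma_comp hp (hγm.const_mul q)),
    integral_const, probReal_univ, one_smul]

theorem averageBER_pdf {n : ℕ} (δ : ℝ) {q : Fin n → ℝ} (hq : ∀ k, 0 ≤ q k) :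
    averageBER δ p q (fun x => (pdf γ P volume x).toReal) =
      δ * ∑ k, (1 / 2 - (∫ w, lowerGamma p (q k * γ w) ∂P) / (2 * Real.Gamma p)) := by
  have hΓ := (Real.Gamma_pos_of_pos hp).ne'
  simp only [averageBER, fun k => setIntegral_upperGamma_mul_pdf hp hγ (hq k), Finset.mul_sum]
  refine Finset.sum_congr rfl fun k _ => ?_
  field_simp

end AverageBER

section DualHop

variable {η N₁ N₂ C : ℝ} {r₁ r₂ : ℕ}

theorem electricalSNR_pos {N : ℝ} (hη : 0 < η) (hN : 0 < N) (r : ℕ) : 0 < electricalSNR η N r := by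
  unfold electricalSNR
  positivity

theorem hopSNR_pos {N x : ℝ} (hη : 0 < η) (hN : 0 < N) (r : ℕ) (hx : 0 < x) :
    0 < hopSNR η N r x := by
  unfold hopSNR
  positivity

theorem endToEndSNR_pos {γ₁ γ₂ : ℝ} (hC : 0 ≤ C) (hγ₁ : 0 < γ₁) (hγ₂ : 0 < γ₂) :
    0 < endToEndSNR C γ₁ γ₂ := by
  unfold endToEndSNR
  positivity

theorem endToEndSNR_hopSNR (N : ℝ) (r : ℕ) (x γ₂ : ℝ) :
    endToEndSNR C (hopSNR η N r x) γ₂ = electricalSNR η N r * (γ₂ / (γ₂ + C)) * x ^ r := by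
  unfold endToEndSNR hopSNR electricalSNR
  rw [mul_pow]
  ring

theorem measurable_endToEndSNR_hopSNR :
    Measurable fun z : ℝ × ℝ => endToEndSNR C (hopSNR η N₁ r₁ z.1) (hopSNR η N₂ r₂ z.2) := by
  unfold endToEndSNR hopSNR
  fun_prop

theorem map_endToEndSNR_absolutelyContinuous {μ₁ μ₂ : Measure ℝ} [SFinite μ₁] [SFinite μ₂]
    (hη : 0 < η) (hN₁ : 0 < N₁) (hN₂ : 0 < N₂) (hC : 0 ≤ C) (hr₁ : r₁ ≠ 0)
    (hμ₁ : μ₁ ≪ volume.restrict (Ioi 0)) (hμ₂ : ∀ᵐ y ∂μ₂, 0 < y) :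
    (μ₁.prod μ₂).map (fun z => endToEndSNR C (hopSNR η N₁ r₁ z.1) (hopSNR η N₂ r₂ z.2)) ≪
      volume := by
  refine map_prod_absolutelyContinuous measurable_endToEndSNR_hopSNR ?_
  filter_upwards [hμ₂] with y hy
  have hγ₂ := hopSNR_pos hη hN₂ r₂ hy
  have hk : electricalSNR η N₁ r₁ * (hopSNR η N₂ r₂ y / (hopSNR η N₂ r₂ y + C)) ≠ 0 := by
    have := electricalSNR_pos hη hN₁ r₁
    positivity
  simp only [endToEndSNR_hopSNR]
  exact (hμ₁.map (by fun_prop)).trans (map_mul_pow_restrict_absolutelyContinuous hk hr₁)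

end DualHop

section Law

variable {Ω : Type*} [MeasurableSpace Ω] {P : Measure Ω} {I₁ I₂ : Ω → ℝ} {μ₁ μ₂ : Measure ℝ}
  {η N₁ N₂ C : ℝ} {r₁ r₂ : ℕ} (hη : 0 < η) (hN₁ : 0 < N₁) (hN₂ : 0 < N₂) (hC : 0 ≤ C)
  (hI₁ : HasLaw I₁ μ₁ P) (hI₂ : HasLaw I₂ μ₂ P)
  (hμ₁ : μ₁ ≪ volume.restrict (Ioi 0)) (hμ₂ : μ₂ ≪ volume.restrict (Ioi 0))

include hη hN₁ hN₂ hC hI₁ hI₂ hμ₁ hμ₂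

theorem hasPDF_endToEndSNR [IsFiniteMeasure P] (hr₁ : r₁ ≠ 0) (hind : IndepFun I₁ I₂ P) :
    HasPDF (fun w => endToEndSNR C (hopSNR η N₁ r₁ (I₁ w)) (hopSNR η N₂ r₂ (I₂ w))) P volume := by
  have := hI₁.isFiniteMeasure_iff.1 inferInstance
  have := hI₂.isFiniteMeasure_iff.1 inferInstance
  have hmeas := measurable_endToEndSNR_hopSNR (η := η) (N₁ := N₁) (N₂ := N₂) (C := C) (r₁ := r₁)
    (r₂ := r₂)
  have hlaw := HasLaw.fun_comp ⟨hmeas.aemeasurable, rfl⟩ (hind.hasLaw_prod hI₁ hI₂)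
  rw [Real.hasPDF_iff_of_aemeasurable hlaw.aemeasurable, hlaw.map_eq]
  exact map_endToEndSNR_absolutelyContinuous hη hN₁ hN₂ hC hr₁ hμ₁
    (hμ₂.ae_le (ae_restrict_mem measurableSet_Ioi))

theorem ae_pos_endToEndSNR :
    ∀ᵐ w ∂P, 0 < endToEndSNR C (hopSNR η N₁ r₁ (I₁ w)) (hopSNR η N₂ r₂ (I₂ w)) := by
  have hpos := ae_restrict_mem (μ := volume) (measurableSet_Ioi (a := (0 : ℝ)))
  filter_upwards [ae_of_ae_map hI₁.aemeasurable (hI₁.map_eq ▸ hμ₁.ae_le hpos),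
    ae_of_ae_map hI₂.aemeasurable (hI₂.map_eq ▸ hμ₂.ae_le hpos)] with w hw₁ hw₂
  exact endToEndSNR_pos hC (hopSNR_pos hη hN₁ r₁ hw₁) (hopSNR_pos hη hN₂ r₂ hw₂)

end Law

section Expectation

variable {η N₁ N₂ C p q a₁ a₂ b₁ b₂ c₁ c₂ : ℝ} {r₁ r₂ : ℕ}

theorem mul_endToEndSNR_genGamma {g : ℝ × ℝ} (hg₁ : 0 ≤ g.1) (hg₂ : 0 < g.2) (hη : 0 < η)
    (hN₂ : 0 < N₂) (hC : 0 ≤ C) (hb₂ : 0 < b₂) :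
    q * endToEndSNR C (hopSNR η N₁ r₁ (b₁ * g.1 ^ (1 / c₁)))
        (hopSNR η N₂ r₂ (b₂ * g.2 ^ (1 / c₂))) =
      q * b₁ ^ r₁ * electricalSNR η N₁ r₁ * g.1 ^ (r₁ / c₁) /
        (1 + C / (b₂ ^ r₂ * electricalSNR η N₂ r₂) * g.2 ^ (-(r₂ / c₂))) := by
  have hpow {x : ℝ} (hx : 0 ≤ x) (c : ℝ) (r : ℕ) : (x ^ (1 / c)) ^ r = x ^ (r / c) := by
    rw [← Real.rpow_mul_natCast hx, one_div_mul_eq_div]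
  have := Real.rpow_pos_of_pos hg₂ (r₂ / c₂)
  simp only [endToEndSNR, hopSNR, electricalSNR, mul_pow, hpow hg₁, hpow hg₂.le,
    Real.rpow_neg hg₂.le]
  field_simp

variable (hη : 0 < η) (hN₁ : 0 < N₁) (hN₂ : 0 < N₂) (hC : 0 < C) (hp : 0 < p) (hq : 0 < q)
  (ha₁ : 0 < a₁) (ha₂ : 0 < a₂) (hb₁ : 0 < b₁) (hb₂ : 0 < b₂) (hc₁ : 0 < c₁) (hc₂ : 0 < c₂)

include hp in
theorem measurable_lowerGamma_endToEndSNR : Measurable fun z : ℝ × ℝ =>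
    lowerGamma p (q * endToEndSNR C (hopSNR η N₁ r₁ z.1) (hopSNR η N₂ r₂ z.2)) :=
  (lowerGamma_mono hp).measurable.comp (measurable_endToEndSNR_hopSNR.const_mul q)

include hp in
theorem integral_lowerGamma_endToEndSNR {Ω : Type*} [MeasurableSpace Ω] {P : Measure Ω}
    [IsFiniteMeasure P] {I₁ I₂ : Ω → ℝ} {ν₁ ν₂ : Measure ℝ} (hI₁ : HasLaw I₁ ν₁ P)
    (hI₂ : HasLaw I₂ ν₂ P) (hind : IndepFun I₁ I₂ P) :
    ∫ w, lowerGamma p (q * endToEndSNR C (hopSNR η N₁ r₁ (I₁ w)) (hopSNR η N₂ r₂ (I₂ w))) ∂P =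
      ∫ z, lowerGamma p (q * endToEndSNR C (hopSNR η N₁ r₁ z.1) (hopSNR η N₂ r₂ z.2))
        ∂ν₁.prod ν₂ := by
  have := hI₁.isFiniteMeasure_iff.1 inferInstance
  have := hI₂.isFiniteMeasure_iff.1 inferInstance
  exact (hind.hasLaw_prod hI₁ hI₂).integral_comp
    (measurable_lowerGamma_endToEndSNR hp).aestronglyMeasurable

include hp in
theorem integrable_lowerGamma_endToEndSNR {μ : Measure (ℝ × ℝ)} [IsFiniteMeasure μ] :
    Integrable (fun z => lowerGamma p (q * endToEndSNR C (hopSNR η N₁ r₁ z.1)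
      (hopSNR η N₂ r₂ z.2))) μ :=
  integrable_lowerGamma_comp hp (measurable_endToEndSNR_hopSNR.const_mul q).aemeasurable

include hη hN₁ hN₂ hC hp hq ha₁ ha₂ hb₁ hb₂ hc₁ hc₂

theorem integral_lowerGamma_endToEndSNR_genGammaMeasure :
    ((∫ z, lowerGamma p (q * endToEndSNR C (hopSNR η N₁ r₁ z.1) (hopSNR η N₂ r₂ z.2))
        ∂(genGammaMeasure a₁ b₁ c₁).prod (genGammaMeasure a₂ b₂ c₂) : ℝ) : ℂ) =
      (berFox p (1 - a₁, r₁ / c₁) (a₂, r₂ / c₂)).foxH (q * b₁ ^ r₁ * electricalSNR η N₁ r₁)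
        (C / (b₂ ^ r₂ * electricalSNR η N₂ r₂)) / (Real.Gamma a₁ * Real.Gamma a₂) := by
  have := isProbabilityMeasure_gammaMeasure ha₁ one_pos
  have := isProbabilityMeasure_gammaMeasure ha₂ one_pos
  have hΓ₁ : (Real.Gamma a₁ : ℂ) ≠ 0 := by exact_mod_cast (Real.Gamma_pos_of_pos ha₁).ne'
  have hΓ₂ : (Real.Gamma a₂ : ℂ) ≠ 0 := by exact_mod_cast (Real.Gamma_pos_of_pos ha₂).ne'
  have hμ₁ := electricalSNR_pos hη hN₁ r₁
  have hμ₂ := electricalSNR_pos hη hN₂ r₂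
  rw [berFox_foxH ha₁ ha₂ (by positivity) (by positivity) (by positivity) (by positivity) hp,
    genGammaMeasure, genGammaMeasure, Measure.map_prod_map _ _ (by fun_prop) (by fun_prop),
    integral_map (by fun_prop) (measurable_lowerGamma_endToEndSNR hp).aestronglyMeasurable,
    Complex.ofReal_mul, Complex.ofReal_mul, mul_div_cancel_left₀ _ (mul_ne_zero hΓ₁ hΓ₂)]
  congr 1
  refine integral_congr_ae ?_
  filter_upwards [Measure.quasiMeasurePreserving_fst.ae (ae_pos_gammaMeasure_one a₁),
    Measure.quasiMeasurePreserving_snd.ae (ae_pos_gammaMeasure_one a₂)] with g hg₁ hg₂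
  simp only [Prod.map_fst, Prod.map_snd, mul_endToEndSNR_genGamma hg₁.le hg₂ hη hN₂ hC.le hb₂]

theorem integral_lowerGamma_endToEndSNR_eggMeasure {ω₁ ω₂ lam₁ lam₂ : ℝ} (hω₁ : ω₁ ∈ Icc 0 1)
    (hω₂ : ω₂ ∈ Icc 0 1) (hlam₁ : 0 < lam₁) (hlam₂ : 0 < lam₂) :
    ((∫ z, lowerGamma p (q * endToEndSNR C (hopSNR η N₁ r₁ z.1) (hopSNR η N₂ r₂ z.2))
        ∂(eggMeasure ω₁ lam₁ a₁ b₁ c₁).prod (eggMeasure ω₂ lam₂ a₂ b₂ c₂) : ℝ) : ℂ) =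
      ω₁ * ω₂ * (berFox p (0, r₁) (1, r₂)).foxH
          (q * lam₁ ^ r₁ * electricalSNR η N₁ r₁) (C / (lam₂ ^ r₂ * electricalSNR η N₂ r₂)) +
      ω₁ * (1 - ω₂) / Real.Gamma a₂ * (berFox p (0, r₁) (a₂, r₂ / c₂)).foxH
          (q * lam₁ ^ r₁ * electricalSNR η N₁ r₁) (C / (b₂ ^ r₂ * electricalSNR η N₂ r₂)) +
      ω₂ * (1 - ω₁) / Real.Gamma a₁ * (berFox p (1 - a₁, r₁ / c₁) (1, r₂)).foxH
          (q * b₁ ^ r₁ * electricalSNR η N₁ r₁) (C / (lam₂ ^ r₂ * electricalSNR η N₂ r₂)) +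
      (1 - ω₁) * (1 - ω₂) / (Real.Gamma a₁ * Real.Gamma a₂) *
        (berFox p (1 - a₁, r₁ / c₁) (a₂, r₂ / c₂)).foxH
          (q * b₁ ^ r₁ * electricalSNR η N₁ r₁) (C / (b₂ ^ r₂ * electricalSNR η N₂ r₂)) := by
  have := isProbabilityMeasure_genGammaMeasure (b := lam₁) (c := 1) one_pos
  have := isProbabilityMeasure_genGammaMeasure (b := lam₂) (c := 1) one_pos
  have := isProbabilityMeasure_genGammaMeasure (b := b₁) (c := c₁) ha₁
  have := isProbabilityMeasure_genGammaMeasure (b := b₂) (c := c₂) ha₂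
  have hint {μ : Measure (ℝ × ℝ)} [IsFiniteMeasure μ] := integrable_lowerGamma_endToEndSNR hp
    (η := η) (N₁ := N₁) (N₂ := N₂) (C := C) (q := q) (r₁ := r₁) (r₂ := r₂) (μ := μ)
  rw [eggMeasure_eq_add_smul hω₁.1 hω₁.2 hlam₁ ha₁ hb₁ hc₁,
    eggMeasure_eq_add_smul hω₂.1 hω₂.2 hlam₂ ha₂ hb₂ hc₂,
    integral_prod_mixture hω₁ hω₂ hint hint hint hint]
  simp only [smul_eq_mul, Complex.ofReal_add, Complex.ofReal_mul, Complex.ofReal_sub,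
    Complex.ofReal_one, integral_lowerGamma_endToEndSNR_genGammaMeasure hη hN₁ hN₂ hC hp hq, ha₁,
    ha₂, hb₁, hb₂, hc₁, hc₂, hlam₁, hlam₂, one_pos]
  simp only [sub_self, div_one, Real.Gamma_one, Complex.ofReal_one, one_mul, mul_one]
  ring

end Expectation

end UWOC

end

open UWOC in
theorem theorem4_general {Ω : Type*} [MeasurableSpace Ω] (P : Measure Ω) [IsProbabilityMeasure P]
    (ω₁ ω₂ lam₁ lam₂ a₁ a₂ b₁ b₂ c₁ c₂ : ℝ)
    (hω₁ : ω₁ ∈ Icc 0 1) (hω₂ : ω₂ ∈ Icc 0 1)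
    (hlam₁ : 0 < lam₁) (hlam₂ : 0 < lam₂) (ha₁ : 0 < a₁) (ha₂ : 0 < a₂)
    (hb₁ : 0 < b₁) (hb₂ : 0 < b₂) (hc₁ : 0 < c₁) (hc₂ : 0 < c₂)
    (I₁ I₂ : Ω → ℝ)
    (hI₁ : HasLaw I₁ (eggMeasure ω₁ lam₁ a₁ b₁ c₁) P)
    (hI₂ : HasLaw I₂ (eggMeasure ω₂ lam₂ a₂ b₂ c₂) P)
    (hind : IndepFun I₁ I₂ P)
    (r₁ r₂ : ℕ) (hr₁ : r₁ ≠ 0)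
    (η N₁ N₂ C : ℝ) (hη : 0 < η) (hN₁ : 0 < N₁) (hN₂ : 0 < N₂) (hC : 0 < C)
    (γ : Ω → ℝ)
    (hγ : ∀ w, γ w = endToEndSNR C (hopSNR η N₁ r₁ (I₁ w)) (hopSNR η N₂ r₂ (I₂ w)))
    (μ₁ μ₂ : ℝ) (hμ₁ : μ₁ = electricalSNR η N₁ r₁) (hμ₂ : μ₂ = electricalSNR η N₂ r₂)
    (n : ℕ) (δ p : ℝ) (q : Fin n → ℝ) (hp : 0 < p) (hq : ∀ k, 0 < q k) :
    HasPDF γ P volume ∧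
    (∀ k, IntegrableOn (fun x => upperGamma p (q k * x) * (pdf γ P volume x).toReal) (Ioi 0)) ∧
    (∀ k,
      (berFox p (0, r₁) (1, r₂)).WellDefinedAt
        (q k * lam₁ ^ r₁ * μ₁) (C / (lam₂ ^ r₂ * μ₂)) ∧
      (berFox p (0, r₁) (a₂, r₂ / c₂)).WellDefinedAt
        (q k * lam₁ ^ r₁ * μ₁) (C / (b₂ ^ r₂ * μ₂)) ∧
      (berFox p (1 - a₁, r₁ / c₁) (1, r₂)).WellDefinedAt
        (q k * b₁ ^ r₁ * μ₁) (C / (lam₂ ^ r₂ * μ₂)) ∧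
      (berFox p (1 - a₁, r₁ / c₁) (a₂, r₂ / c₂)).WellDefinedAt
        (q k * b₁ ^ r₁ * μ₁) (C / (b₂ ^ r₂ * μ₂))) ∧
    (averageBER δ p q (fun x => (pdf γ P volume x).toReal) : ℂ) =
      δ * ∑ k, (1 / 2
        - ω₁ * ω₂ / (2 * Real.Gamma p) *
          (berFox p (0, r₁) (1, r₂)).foxH
            (q k * lam₁ ^ r₁ * μ₁) (C / (lam₂ ^ r₂ * μ₂))
        - ω₁ * (1 - ω₂) / (2 * Real.Gamma a₂ * Real.Gamma p) *
          (berFox p (0, r₁) (a₂, r₂ / c₂)).foxH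
            (q k * lam₁ ^ r₁ * μ₁) (C / (b₂ ^ r₂ * μ₂))
        - ω₂ * (1 - ω₁) / (2 * Real.Gamma a₁ * Real.Gamma p) *
          (berFox p (1 - a₁, r₁ / c₁) (1, r₂)).foxH
            (q k * b₁ ^ r₁ * μ₁) (C / (lam₂ ^ r₂ * μ₂))
        - (1 - ω₁) * (1 - ω₂) / (2 * Real.Gamma a₁ * Real.Gamma a₂ * Real.Gamma p) *
          (berFox p (1 - a₁, r₁ / c₁) (a₂, r₂ / c₂)).foxH
            (q k * b₁ ^ r₁ * μ₁) (C / (b₂ ^ r₂ * μ₂))) := by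
  obtain rfl := funext hγ
  have hμ₁' : 0 < μ₁ := hμ₁ ▸ electricalSNR_pos hη hN₁ r₁
  have hμ₂' : 0 < μ₂ := hμ₂ ▸ electricalSNR_pos hη hN₂ r₂
  have hac₁ := eggMeasure_absolutelyContinuous (ω := ω₁) (lam := lam₁) (a := a₁) (b := b₁) (c := c₁)
  have hac₂ := eggMeasure_absolutelyContinuous (ω := ω₂) (lam := lam₂) (a := a₂) (b := b₂) (c := c₂)
  have hpdf := hasPDF_endToEndSNR hη hN₁ hN₂ hC.le hI₁ hI₂ hac₁ hac₂ (r₂ := r₂) hr₁ hind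
  have hpos := ae_pos_endToEndSNR hη hN₁ hN₂ hC.le hI₁ hI₂ hac₁ hac₂ (r₁ := r₁) (r₂ := r₂)
  refine ⟨hpdf, fun k => integrableOn_upperGamma_mul_pdf hp hpos (hq k).le, fun k => ?_, ?_⟩
  · have hqk := hq k
    rw [← sub_self (1 : ℝ)]
    refine ⟨?_, ?_, ?_, ?_⟩ <;> apply berFox_wellDefinedAt <;> positivity
  · have hΓp : (Real.Gamma p : ℂ) ≠ 0 := by exact_mod_cast (Real.Gamma_pos_of_pos hp).ne'
    simp only [averageBER_pdf hp hpos δ fun k => (hq k).le, Complex.ofReal_mul, Complex.ofReal_sum,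
      Complex.ofReal_sub, Complex.ofReal_div, integral_lowerGamma_endToEndSNR hp hI₁ hI₂ hind,
      integral_lowerGamma_endToEndSNR_eggMeasure hη hN₁ hN₂ hC hp (hq _) ha₁ ha₂ hb₁ hb₂ hc₁ hc₂
        hω₁ hω₂ hlam₁ hlam₂, ← hμ₁, ← hμ₂]
    congr! 2 with k
    push_cast
    field_simp
    ring

open UWOC in
theorem theorem4 {Ω : Type*} [MeasurableSpace Ω] (P : Measure Ω) [IsProbabilityMeasure P]
    (ω₁ ω₂ lam₁ lam₂ a₁ a₂ b₁ b₂ c₁ c₂ : ℝ)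
    (hω₁ : 0 < ω₁ ∧ ω₁ < 1) (hω₂ : 0 < ω₂ ∧ ω₂ < 1)
    (hlam₁ : 0 < lam₁) (hlam₂ : 0 < lam₂) (ha₁ : 0 < a₁) (ha₂ : 0 < a₂)
    (hb₁ : 0 < b₁) (hb₂ : 0 < b₂) (hc₁ : 0 < c₁) (hc₂ : 0 < c₂)
    (I₁ I₂ : Ω → ℝ)
    (hI₁ : HasLaw I₁ (eggMeasure ω₁ lam₁ a₁ b₁ c₁) P)
    (hI₂ : HasLaw I₂ (eggMeasure ω₂ lam₂ a₂ b₂ c₂) P)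
    (hind : IndepFun I₁ I₂ P)
    (r₁ r₂ : ℕ) (hr₁ : r₁ = 1 ∨ r₁ = 2) (hr₂ : r₂ = 1 ∨ r₂ = 2)
    (η N₁ N₂ C : ℝ) (hη : 0 < η) (hN₁ : 0 < N₁) (hN₂ : 0 < N₂) (hC : 0 < C)
    (γ : Ω → ℝ)
    (hγ : ∀ w, γ w = endToEndSNR C (hopSNR η N₁ r₁ (I₁ w)) (hopSNR η N₂ r₂ (I₂ w)))
    (μ₁ μ₂ : ℝ) (hμ₁ : μ₁ = electricalSNR η N₁ r₁) (hμ₂ : μ₂ = electricalSNR η N₂ r₂)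
    (n : ℕ) (δ p : ℝ) (q : Fin n → ℝ) (hp : 0 < p) (hq : ∀ k, 0 < q k) :
    HasPDF γ P volume ∧
    (∀ k, IntegrableOn (fun x => upperGamma p (q k * x) * (pdf γ P volume x).toReal) (Ioi 0)) ∧
    (∀ k,
      (berFox p (0, r₁) (1, r₂)).WellDefinedAt
        (q k * lam₁ ^ r₁ * μ₁) (C / (lam₂ ^ r₂ * μ₂)) ∧
      (berFox p (0, r₁) (a₂, r₂ / c₂)).WellDefinedAt
        (q k * lam₁ ^ r₁ * μ₁) (C / (b₂ ^ r₂ * μ₂)) ∧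
      (berFox p (1 - a₁, r₁ / c₁) (1, r₂)).WellDefinedAt
        (q k * b₁ ^ r₁ * μ₁) (C / (lam₂ ^ r₂ * μ₂)) ∧
      (berFox p (1 - a₁, r₁ / c₁) (a₂, r₂ / c₂)).WellDefinedAt
        (q k * b₁ ^ r₁ * μ₁) (C / (b₂ ^ r₂ * μ₂))) ∧
    (averageBER δ p q (fun x => (pdf γ P volume x).toReal) : ℂ) =
      δ * ∑ k, (1 / 2
        - ω₁ * ω₂ / (2 * Real.Gamma p) *
          (berFox p (0, r₁) (1, r₂)).foxH
            (q k * lam₁ ^ r₁ * μ₁) (C / (lam₂ ^ r₂ * μ₂))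
        - ω₁ * (1 - ω₂) / (2 * Real.Gamma a₂ * Real.Gamma p) *
          (berFox p (0, r₁) (a₂, r₂ / c₂)).foxH
            (q k * lam₁ ^ r₁ * μ₁) (C / (b₂ ^ r₂ * μ₂))
        - ω₂ * (1 - ω₁) / (2 * Real.Gamma a₁ * Real.Gamma p) *
          (berFox p (1 - a₁, r₁ / c₁) (1, r₂)).foxH
            (q k * b₁ ^ r₁ * μ₁) (C / (lam₂ ^ r₂ * μ₂))
        - (1 - ω₁) * (1 - ω₂) / (2 * Real.Gamma a₁ * Real.Gamma a₂ * Real.Gamma p) *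
          (berFox p (1 - a₁, r₁ / c₁) (a₂, r₂ / c₂)).foxH
            (q k * b₁ ^ r₁ * μ₁) (C / (b₂ ^ r₂ * μ₂))) := by
  exact theorem4_general P ω₁ ω₂ lam₁ lam₂ a₁ a₂ b₁ b₂ c₁ c₂ ⟨hω₁.1.le, hω₁.2.le⟩
    ⟨hω₂.1.le, hω₂.2.le⟩ hlam₁ hlam₂ ha₁ ha₂ hb₁ hb₂ hc₁ hc₂ I₁ I₂ hI₁ hI₂ hind r₁ r₂ (by lia)
    η N₁ N₂ C hη hN₁ hN₂ hC γ hγ μ₁ μ₂ hμ₁ hμ₂ n δ p q hp hq
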